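/- Let $K$ be a perfect field, and let $\mathbb{X}$ be a $0$-dimensional closed subscheme of projective space $\mathbb{P}^n$ over $K$, with saturated homogeneous vanishing ideal $I_{\mathbb{X}} \subseteq P = K[X_0,\dots,X_n]$, such that no point of the support of $\mathbb{X}$ lies on the hyperplane $X_0=0$. Let $R = P/I_{\mathbb{X}}$ be the homogeneous coordinate ring of $\mathbb{X}$, let $x_0\in R$ be the image of $X_0$, and let $S = R/\langle x_0-1\rangle$ be the affine coordinate ring of $\mathbb{X}$ in $D_+(X_0)\cong\mathbb{A}^n$. For a $K$-algebra $A$ write $\Omega^m_{A/K} = \Lambda^m_A\,\Omega^1_{A/K}$ for the module of Kähler differential $m$-forms; the $R$-modules $\Omega^m_{R/K}$ are graded, a form $f\,dg_1\wedge\cdots\wedge dg_m$ with $f,g_1,\dots,g_m\in R$ homogeneous having degree $\deg f+\sum_j\deg g_j$. For $m\ge 1$ the Hilbert functions $i\mapsto \dim_K R_i$ and $i\mapsto\dim_K(\Omega^m_{R/K})_i$ are constant for $i\gg 0$; their eventual values are denoted by $\deg(\mathbb{X})$ and $\operatorname{HP}(\Omega^m_{R/K})$. The scheme $\mathbb{X}$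 is called weakly curvilinear if the maximal ideal of each of its local rings (the localizations of $S$ at its maximal ideals) is generated by one element. The following conditions are equivalent. (a) The scheme $\mathbb{X}$ is weakly curvilinear, but not smooth over $K$. (b) We have $\Omega^1_{S/K}\ne 0$ and $\Omega^m_{S/K}=0$ for all $m\ge 2$. (c) We have $\operatorname{HP}(\Omega^1_{R/K})>\deg(\mathbb{X})$, $\operatorname{HP}(\Omega^2_{R/K})=\operatorname{HP}(\Omega^1_{R/K})-\deg(\mathbb{X})$, and $\operatorname{HP}(\Omega^m_{R/K})=0$ for all $m>2$. -/

import Mathlib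

open scoped KaehlerDifferential

noncomputable section

universe u

attribute [local instance] MvPolynomial.gradedAlgebra

/-- The module of Kähler differential `m`-forms `Ω^m_{A/K}`, the `m`-th exterior power over `A`
of the module of Kähler differentials `Ω[A⁄K]`. -/
abbrev KaehlerForms (K : Type u) [CommRing K] (A : Type u) [CommRing A] [Algebra K A] (m : ℕ) :
    Type u :=
  ⋀[A]^m (Ω[A⁄K])

/-- The value `f i` for all large `i`, for a function that is eventually constant
(and `0` otherwise). -/
def eventualValue (f : ℕ → ℤ) : ℤ :=
  open Classical in
  if h : ∃ c : ℤ, ∀ᶠ i in Filter.atTop, f i = c then h.choose else 0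

/-- A local ring is weakly curvilinear if its maximal ideal is generated by one element. -/
def IsWeaklyCurvilinearLocalRing (T : Type u) [CommRing T] [IsLocalRing T] : Prop :=
  ∃ a : T, IsLocalRing.maximalIdeal T = Ideal.span {a}

/-- All the localizations of `A` at its maximal ideals are weakly curvilinear. For an Artinian
ring these localizations are the quotients of `A` by the primary components of its zero ideal. -/
def HasWeaklyCurvilinearLocalRings (A : Type u) [CommRing A] : Prop :=
  ∀ (M : Ideal A) [M.IsMaximal], IsWeaklyCurvilinearLocalRing (Localization.AtPrime M)

/-- A 0-dimensional closed subscheme `X` of projective `n`-space over `K`, given by its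
homogeneous vanishing ideal (closed subschemes of projective space correspond bijectively to
saturated homogeneous ideals), such that no point of the support of `X` lies in the hyperplane
`X₀ = 0`. -/
structure ZeroDimProjScheme (K : Type u) [Field K] (n : ℕ) where
  /-- The homogeneous vanishing ideal of `X` in `P = K[X₀, …, Xₙ]`. -/
  vanishingIdeal : Ideal (MvPolynomial (Fin (n + 1)) K)
  isHomogeneous :
    vanishingIdeal.IsHomogeneous (MvPolynomial.homogeneousSubmodule (Fin (n + 1)) K)
  /-- If `f` is multiplied into the vanishing ideal by a power of the ideal `⟨X₀, …, Xₙ⟩`, then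
  `f` lies in the vanishing ideal. -/
  isSaturated : ∀ (k : ℕ) (f : MvPolynomial (Fin (n + 1)) K),
    (∀ g ∈ (Ideal.span (Set.range MvPolynomial.X) : Ideal (MvPolynomial (Fin (n + 1)) K)) ^ k,
      g * f ∈ vanishingIdeal) → f ∈ vanishingIdeal
  /-- The support of `X`, as a subspace of `Proj P`, has dimension zero. -/
  dim_eq_zero : topologicalKrullDim
    (ProjectiveSpectrum.zeroLocus (MvPolynomial.homogeneousSubmodule (Fin (n + 1)) K)
      (vanishingIdeal : Set (MvPolynomial (Fin (n + 1)) K))) = 0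
  /-- No point of the support of `X` lies in the hyperplane `X₀ = 0`. -/
  avoids_hyperplane :
    ∀ p ∈ ProjectiveSpectrum.zeroLocus (MvPolynomial.homogeneousSubmodule (Fin (n + 1)) K)
      (vanishingIdeal : Set (MvPolynomial (Fin (n + 1)) K)),
      (MvPolynomial.X 0 : MvPolynomial (Fin (n + 1)) K) ∉ p.asHomogeneousIdeal

namespace ZeroDimProjScheme

variable {K : Type u} [Field K] {n : ℕ} (X : ZeroDimProjScheme K n)

/-- The homogeneous coordinate ring `R = P / I_X`. -/
abbrev homogCoordRing : Type u :=
  MvPolynomial (Fin (n + 1)) K ⧸ X.vanishingIdeal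

/-- The homogeneous component `R_i` of the homogeneous coordinate ring. -/
def homogComponent (i : ℕ) : Submodule K X.homogCoordRing :=
  (MvPolynomial.homogeneousSubmodule (Fin (n + 1)) K i).map
    (Ideal.Quotient.mkₐ K X.vanishingIdeal).toLinearMap

/-- The image `x₀` of `X₀` in `R`. -/
def x₀ : X.homogCoordRing :=
  Ideal.Quotient.mk X.vanishingIdeal (MvPolynomial.X 0)

/-- The affine coordinate ring `S = R / ⟨x₀ - 1⟩` of `X`, viewed as a closed subscheme of the
affine space `D₊(X₀)`. Thus `X` is the spectrum of `S`. -/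
abbrev affineCoordRing : Type u :=
  X.homogCoordRing ⧸ Ideal.span {X.x₀ - 1}

/-- The Hilbert function `i ↦ dim_K R_i` of `X`. -/
def hilbertFunction (i : ℕ) : ℤ :=
  Module.finrank K (X.homogComponent i)

/-- The degree of `X`: the value of the constant Hilbert polynomial of `R`. -/
def degree : ℤ :=
  eventualValue X.hilbertFunction

/-- The homogeneous component of degree `i` of `Ω^m_{R/K}`: the `K`-span of the forms
`f dg₁ ∧ ⋯ ∧ dg_m` with homogeneous `f, g₁, …, g_m` whose degrees add up to `i`. -/
def formsComponent (m i : ℕ) : Submodule K (KaehlerForms K X.homogCoordRing m) :=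
  Submodule.span K
    {ω | ∃ (a : ℕ) (b : Fin m → ℕ) (f : X.homogCoordRing) (g : Fin m → X.homogCoordRing),
      f ∈ X.homogComponent a ∧ (∀ j, g j ∈ X.homogComponent (b j)) ∧ a + ∑ j, b j = i ∧
      ω = f • exteriorPower.ιMulti X.homogCoordRing m
        (fun j => KaehlerDifferential.D K X.homogCoordRing (g j))}

/-- The Hilbert function `i ↦ dim_K (Ω^m_{R/K})_i`. -/
def formsHilbertFunction (m i : ℕ) : ℤ :=
  Module.finrank K (X.formsComponent m i)

/-- The constant Hilbert polynomial `HP(Ω^m_{R/K})`. -/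
def formsHilbertPoly (m : ℕ) : ℤ :=
  eventualValue (X.formsHilbertFunction m)

/-- `X`, the spectrum of `S`, is smooth over `K`. -/
def IsSmooth : Prop :=
  Algebra.Smooth K X.affineCoordRing

/-- `X`, the spectrum of `S`, is weakly curvilinear if all its local rings are. -/
def IsWeaklyCurvilinear : Prop :=
  HasWeaklyCurvilinearLocalRings X.affineCoordRing

end ZeroDimProjScheme

end

/-! Everything is transported to the finite `K`-algebra `S`. No point of the support lies on `X₀ =
0`, so multiplication by `x₀` maps `R_i` onto `R_{i+1}` for large `i`; by the chain rule the same
holds for the graded pieces of `Ω^m_{R/K}`. Surjections between finite dimensional spaces are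
eventually bijective, and the pieces are then identified with the module modulo `x₀ - 1`. For `R`
this quotient is `S`. For one-forms it is `S ⊕ Ω_S`: the conormal sequence of `R → S` is split by
the Euler derivation, which takes the value `1` at `x₀`. Hence `deg X = dim S` and `HP(Ω^m_R) = dim
⋀^m_S (S ⊕ Ω_S)` (`exists_kaehlerDifferential_prod`, `finite_and_eventually_finrank_eq`).

In particular `HP(Ω^1_R) - deg X = dim Ω_S`. If `⋀² Ω_S = 0`, then `⋀² (S ⊕ Ω_S) ≃ Ω_S` and the
higher powers vanish; conversely, `⋀³ (S ⊕ Ω_S) = 0` forces `⋀² Ω_S = 0`. This gives (b) ↔ (c).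

For (a) ↔ (b), perfectness of `K` gives `M/M² ≅ Ω_S/MΩ_S` at each maximal ideal `M`. By Nakayama,
weak curvilinearity says that these spaces have dimension at most one, and so does `⋀² Ω_S = 0`
(`hasWeaklyCurvilinearLocalRings_iff`). Finally, a finite `K`-algebra is smooth exactly when `Ω_S =
0`. -/

open scoped KaehlerDifferential TensorProduct

universe u

attribute [local instance] MvPolynomial.gradedAlgebra

/-! ### Base change of exterior algebras -/

section ExteriorBaseChange

variable {R A M : Type*} [CommRing R] [CommRing A] [Algebra R A] [AddCommGroup M] [Module R M]

theorem ExteriorAlgebra.baseChange_ι_add_mul_swap (x y : A ⊗[R] M) :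
    (ExteriorAlgebra.ι R).baseChange A x * (ExteriorAlgebra.ι R).baseChange A y +
      (ExteriorAlgebra.ι R).baseChange A y * (ExteriorAlgebra.ι R).baseChange A x = 0 := by
  induction x with
  | zero => simp
  | add x₁ x₂ h₁ h₂ =>
    rw [map_add, add_mul, mul_add, ← add_zero (0 : A ⊗[R] ExteriorAlgebra R M)]
    nth_rw 1 [← h₁]
    rw [← h₂]
    abel
  | tmul a m =>
    induction y with
    | zero => simp
    | add y₁ y₂ h₁ h₂ =>
      rw [map_add, add_mul, mul_add, ← add_zero (0 : A ⊗[R] ExteriorAlgebra R M)]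
      nth_rw 1 [← h₁]
      rw [← h₂]
      abel
    | tmul b n =>
      simp only [LinearMap.baseChange_tmul, Algebra.TensorProduct.tmul_mul_tmul]
      rw [mul_comm b a, ← TensorProduct.tmul_add, ExteriorAlgebra.ι_add_mul_swap,
        TensorProduct.tmul_zero]

/-- Pure tensors square to zero because `ι m` does, and the cross terms of a sum cancel by
anticommutativity. This allows maps out of an exterior algebra to be built with values in `A ⊗
ExteriorAlgebra R M`. -/
theorem ExteriorAlgebra.baseChange_ι_mul_self (x : A ⊗[R] M) :
    (ExteriorAlgebra.ι R).baseChange A x * (ExteriorAlgebra.ι R).baseChange A x = 0 := by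
  induction x with
  | zero => simp
  | add x₁ x₂ h₁ h₂ =>
    rw [map_add, add_mul, mul_add, mul_add, h₁, h₂, zero_add, add_zero,
      ExteriorAlgebra.baseChange_ι_add_mul_swap]
  | tmul a m => simp

end ExteriorBaseChange

/-! ### Exterior powers modulo one ring element -/

section ExteriorQuotient

variable {R S N N' : Type*} [CommRing R] [CommRing S] [Algebra R S] [AddCommGroup N] [Module R N]
  [AddCommGroup N'] [Module R N'] [Module S N'] [IsScalarTower R S N']

/-- The map `⋀[R]^m N → ⋀[S]^m N'` induced by an `R`-linear map from `N` to an `S`-module. -/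
noncomputable def exteriorPower.mapRestrict (m : ℕ) (π : N →ₗ[R] N') : ⋀[R]^m N →ₗ[R] ⋀[S]^m N' :=
  exteriorPower.alternatingMapLinearEquiv
    { (((exteriorPower.ιMulti S m (M := N')).toMultilinearMap.restrictScalars R).compLinearMap
        fun _ => π) with
      map_eq_zero_of_eq' := fun v _ _ h hij =>
        (exteriorPower.ιMulti S m (M := N')).map_eq_zero_of_eq (fun k => π (v k))
          (congrArg π h) hij }

theorem exteriorPower.mapRestrict_ιMulti (m : ℕ) (π : N →ₗ[R] N') (v : Fin m → N) :
    exteriorPower.mapRestrict (S := S) m π (exteriorPower.ιMulti R m v) =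
      exteriorPower.ιMulti S m (fun i => π (v i)) := by
  simp only [mapRestrict, alternatingMapLinearEquiv_apply_ιMulti]
  rfl

theorem exteriorPower.mapRestrict_surjective (m : ℕ) {π : N →ₗ[R] N'}
    (hπ : Function.Surjective π) (hS : Function.Surjective (algebraMap R S)) :
    Function.Surjective (exteriorPower.mapRestrict (S := S) m π) := by
  intro ω
  have hω : ω ∈ Submodule.span S (Set.range (exteriorPower.ιMulti S m (M := N'))) := by
    rw [exteriorPower.ιMulti_span]; trivial
  induction hω using Submodule.span_induction with
  | mem x hx =>
    obtain ⟨v, rfl⟩ := hx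
    choose w hw using fun i => hπ (v i)
    exact ⟨exteriorPower.ιMulti R m w, by rw [mapRestrict_ιMulti]; simp only [hw]⟩
  | zero => exact ⟨0, map_zero _⟩
  | add x y _ _ hx hy =>
    obtain ⟨a, rfl⟩ := hx
    obtain ⟨b, rfl⟩ := hy
    exact ⟨a + b, map_add _ _ _⟩
  | smul s x _ hx =>
    obtain ⟨a, rfl⟩ := hx
    obtain ⟨r, rfl⟩ := hS s
    exact ⟨r • a, by rw [map_smul, algebraMap_smul]⟩

/-- If `1 ⊗ ω = 0` in `R/c ⊗ ⋀ N` for an `m`-form `ω`, then `ω` is divisible by `c`. -/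
theorem exteriorPower.exists_smul_eq_of_tmul_eq_zero {c : R}
    (hS : Function.Surjective (algebraMap R S))
    (hker : RingHom.ker (algebraMap R S) = Ideal.span {c}) {m : ℕ} (ω : ⋀[R]^m N)
    (h : (1 : S) ⊗ₜ[R] (ω : ExteriorAlgebra R N) = 0) : ∃ η : ⋀[R]^m N, ω = c • η := by
  have hmem : (ω : ExteriorAlgebra R N) ∈
      (Ideal.span {c} • ⊤ : Submodule R (ExteriorAlgebra R N)) := by
    let e : (R ⧸ Ideal.span {c}) ≃ₗ[R] S :=
      ((Submodule.quotEquivOfEq _ _ (by rw [← hker]; rfl)).trans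
        ((Algebra.linearMap R S).quotKerEquivOfSurjective hS))
    have he : e 1 = 1 := by
      change Algebra.linearMap R S 1 = 1
      simp
    have h2 : (LinearMap.rTensor (ExteriorAlgebra R N) e.symm.toLinearMap)
        ((1 : S) ⊗ₜ[R] (ω : ExteriorAlgebra R N)) = 0 := by rw [h, map_zero]
    rw [LinearMap.rTensor_tmul, LinearEquiv.coe_coe, ← he, e.symm_apply_apply] at h2
    have h3 := congrArg (TensorProduct.quotTensorEquivQuotSMul
      (ExteriorAlgebra R N) (Ideal.span {c})) h2
    rw [map_zero, ← map_one (Ideal.Quotient.mk (Ideal.span {c})),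
      TensorProduct.quotTensorEquivQuotSMul_mk_tmul, one_smul] at h3
    exact (Submodule.Quotient.mk_eq_zero _).1 h3
  rw [Submodule.ideal_span_singleton_smul] at hmem
  obtain ⟨η, -, hη⟩ := (Submodule.mem_smul_pointwise_iff_exists _ _ _).1 hmem
  -- This `η` lives in the whole exterior algebra; its degree `m` component is also a quotient of
  -- `ω` by `c`, as `ω` is homogeneous.
  refine ⟨DirectSum.decompose (fun i : ℕ => ⋀[R]^i N) η m, ?_⟩
  apply Subtype.ext
  have h4 := congrArg (fun z => ((DirectSum.decompose (fun i : ℕ => ⋀[R]^i N) z m :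
    ⋀[R]^m N) : ExteriorAlgebra R N)) hη
  simp only [DirectSum.decompose_smul, DirectSum.decompose_coe, DirectSum.of_eq_same] at h4
  rw [← h4]
  rfl

/-- Since `ker π` is contained in `cN`, the map `n ↦ 1 ⊗ ι n` descends to `N'`. Its values square to
zero, so it extends to an algebra map `F` on the exterior algebra of `N'` over `S`. As `F` sends the
image of `ω` to `1 ⊗ ω`, the latter vanishes, so `c` divides `ω`. -/
theorem exteriorPower.exists_smul_eq_of_mapRestrict_eq_zero {c : R}
    (hS : Function.Surjective (algebraMap R S))
    (hker : RingHom.ker (algebraMap R S) = Ideal.span {c}) (m : ℕ) {π : N →ₗ[R] N'}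
    (hπ : Function.Surjective π) (hπk : ∀ n, π n = 0 → ∃ n', n = c • n') (ω : ⋀[R]^m N)
    (h : exteriorPower.mapRestrict (S := S) m π ω = 0) : ∃ η : ⋀[R]^m N, ω = c • η := by
  have hc : algebraMap R S c = 0 := by
    rw [← RingHom.mem_ker, hker]; exact Ideal.mem_span_singleton_self c
  let g : N →ₗ[R] S ⊗[R] ExteriorAlgebra R N :=
    (TensorProduct.mk R S (ExteriorAlgebra R N) 1).comp (ExteriorAlgebra.ι R)
  have hg : LinearMap.ker π ≤ LinearMap.ker g := by
    intro n hn
    obtain ⟨n', rfl⟩ := hπk n hn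
    rw [LinearMap.mem_ker, map_smul, ← algebraMap_smul S c, hc, zero_smul]
  let ℓ₀ : N' →ₗ[R] S ⊗[R] ExteriorAlgebra R N :=
    ((LinearMap.ker π).liftQ g hg).comp (π.quotKerEquivOfSurjective hπ).symm.toLinearMap
  have hℓ₀ (n : N) : ℓ₀ (π n) = g n := by
    simp only [ℓ₀, LinearMap.comp_apply, LinearEquiv.coe_coe]
    rw [← LinearMap.quotKerEquivOfSurjective_apply_mk π hπ, LinearEquiv.symm_apply_apply]
    rfl
  let ℓ : N' →ₗ[S] S ⊗[R] ExteriorAlgebra R N := ℓ₀.extendScalarsOfSurjective hS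
  have hsq (n' : N') : ℓ n' * ℓ n' = 0 := by
    obtain ⟨n, rfl⟩ := hπ n'
    change ℓ₀ (π n) * ℓ₀ (π n) = 0
    rw [hℓ₀]
    simp [g]
  let F := ExteriorAlgebra.lift S ⟨ℓ, hsq⟩
  have key : ∀ ω : ⋀[R]^m N, F (exteriorPower.mapRestrict (S := S) m π ω) =
      (1 : S) ⊗ₜ[R] (ω : ExteriorAlgebra R N) := by
    intro ω
    have hω : ω ∈ Submodule.span R (Set.range (exteriorPower.ιMulti R m (M := N))) := by
      rw [exteriorPower.ιMulti_span]; trivial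
    induction hω using Submodule.span_induction with
    | mem x hx =>
      obtain ⟨v, rfl⟩ := hx
      rw [mapRestrict_ιMulti]
      simp only [exteriorPower.ιMulti_apply_coe, ExteriorAlgebra.ιMulti_apply, map_list_prod,
        List.map_ofFn, Function.comp_def]
      have h1 : (1 : S) ⊗ₜ[R] (List.ofFn fun i => ExteriorAlgebra.ι R (v i)).prod =
          (Algebra.TensorProduct.includeRight : ExteriorAlgebra R N →ₐ[R] _)
            (List.ofFn fun i => ExteriorAlgebra.ι R (v i)).prod := rfl
      rw [h1, map_list_prod, List.map_ofFn]
      congr 2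
      funext i
      simp only [F, ExteriorAlgebra.lift_ι_apply, Function.comp_def]
      exact hℓ₀ (v i)
    | zero => simp
    | add x y _ _ hx hy => simp only [map_add, Submodule.coe_add, hx, hy, TensorProduct.tmul_add]
    | smul r x _ hx =>
      rw [map_smul, Submodule.coe_smul, TensorProduct.tmul_smul, ← hx,
        ← algebraMap_smul S r (mapRestrict (S := S) m π x), Submodule.coe_smul, map_smul,
        algebraMap_smul]
  refine exteriorPower.exists_smul_eq_of_tmul_eq_zero hS hker ω ?_
  rw [← key, h]
  simp

end ExteriorQuotient

/-! ### Exterior powers of `S × Q` -/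

section ExteriorProd

variable {S Q : Type*} [CommRing S] [AddCommGroup Q] [Module S Q]

theorem ExteriorAlgebra.ι_mul_ι_eq_zero_of_subsingleton [Subsingleton (⋀[S]^2 Q)] (a b : Q) :
    ExteriorAlgebra.ι S a * ExteriorAlgebra.ι S b = 0 := by
  have h : exteriorPower.ιMulti S 2 ![a, b] = 0 := Subsingleton.elim _ _
  simpa [ExteriorAlgebra.ιMulti_apply] using congrArg Subtype.val h

theorem ExteriorAlgebra.ι_prod_eq (v : S × Q) :
    ExteriorAlgebra.ι S v = v.1 • ExteriorAlgebra.ι S ((1, 0) : S × Q) +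
      ExteriorAlgebra.ι S ((0, v.2) : S × Q) := by
  rw [← map_smul, ← map_add]
  congr 1
  ext <;> simp

/-- Write `v = v.1 • e + v.2` with `e = (1, 0)`. The product of the `Q`-parts dies because `⋀² Q =
0`, `e` squares to zero, and anticommutativity collects the mixed terms. -/
theorem ExteriorAlgebra.ι_prod_mul_ι_prod [Subsingleton (⋀[S]^2 Q)] (v w : S × Q) :
    ExteriorAlgebra.ι S v * ExteriorAlgebra.ι S w =
      ExteriorAlgebra.ι S ((1, 0) : S × Q) *
        ExteriorAlgebra.ι S ((0, v.1 • w.2 - w.1 • v.2) : S × Q) := by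
  have h0 : ExteriorAlgebra.ι S ((0, v.2) : S × Q) * ExteriorAlgebra.ι S ((0, w.2) : S × Q) = 0 := by
    have h := congrArg (ExteriorAlgebra.map (LinearMap.inr S S Q))
      (ExteriorAlgebra.ι_mul_ι_eq_zero_of_subsingleton v.2 w.2)
    simpa only [map_mul, map_zero, ExteriorAlgebra.map_apply_ι, LinearMap.inr_apply] using h
  have h1 : ((0, v.1 • w.2 - w.1 • v.2) : S × Q) = v.1 • (0, w.2) - w.1 • (0, v.2) := by
    ext <;> simp
  have h2 : ExteriorAlgebra.ι S ((0, v.2) : S × Q) * ExteriorAlgebra.ι S ((1, 0) : S × Q) =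
      - (ExteriorAlgebra.ι S ((1, 0) : S × Q) * ExteriorAlgebra.ι S ((0, v.2) : S × Q)) :=
    eq_neg_of_add_eq_zero_left (ExteriorAlgebra.ι_add_mul_swap _ _)
  rw [ExteriorAlgebra.ι_prod_eq v, ExteriorAlgebra.ι_prod_eq w, h1, map_sub, map_smul, map_smul]
  simp only [add_mul, mul_add, mul_sub, smul_mul_assoc, mul_smul_comm,
    ExteriorAlgebra.ι_sq_zero, h0, h2, smul_zero]
  rw [zero_add, smul_neg]
  abel

theorem exteriorPower.subsingleton_prod_of_subsingleton [Subsingleton (⋀[S]^2 Q)] {m : ℕ}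
    (hm : 3 ≤ m) : Subsingleton (⋀[S]^m (S × Q)) := by
  obtain ⟨k, rfl⟩ := Nat.exists_eq_add_of_le hm
  rw [← Submodule.subsingleton_iff S, ← subsingleton_iff_bot_eq_top, ← exteriorPower.ιMulti_span,
    eq_comm, Submodule.span_eq_bot]
  rintro _ ⟨v, rfl⟩
  apply Subtype.ext
  rw [exteriorPower.ιMulti_apply_coe, ExteriorAlgebra.ιMulti_apply, List.ofFn_add, List.prod_append]
  have h : (List.ofFn fun i : Fin 3 => ExteriorAlgebra.ι S (v (i.castLE (by omega)))).prod = 0 := by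
    simp only [List.ofFn_succ, List.ofFn_zero, List.prod_cons, List.prod_nil, mul_one]
    -- The first two rewrites bring the triple product to `e` times two elements of `Q`; the third
    -- then has both `S`-coordinates equal to zero.
    rw [ExteriorAlgebra.ι_prod_mul_ι_prod, ← mul_assoc, ExteriorAlgebra.ι_prod_mul_ι_prod,
      mul_assoc, ExteriorAlgebra.ι_prod_mul_ι_prod, zero_smul, zero_smul, sub_zero]
    change _ * (_ * ExteriorAlgebra.ι S (0 : S × Q)) = 0
    rw [map_zero, mul_zero, mul_zero]
  exact (congrArg (· * _) h).trans (zero_mul _)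

variable (S Q) in
/-- Contraction of forms on `S × Q` with the projection to `S`, followed by restriction to `Q`. -/
noncomputable def exteriorPower.contractFst (m : ℕ) : ⋀[S]^(m + 1) (S × Q) →ₗ[S] ⋀[S]^m Q :=
  exteriorPower.alternatingMapLinearEquiv
    (AlternatingMap.alternatizeUncurryFin ((LinearMap.fst S S Q).smulRight
      ((exteriorPower.ιMulti S m (M := Q)).compLinearMap (LinearMap.snd S S Q))))

theorem exteriorPower.contractFst_ιMulti (m : ℕ) (v : Fin (m + 1) → S × Q) :
    exteriorPower.contractFst S Q m (exteriorPower.ιMulti S (m + 1) v) =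
      ∑ i : Fin (m + 1), (-1) ^ (i : ℕ) • (v i).1 •
        exteriorPower.ιMulti S m (fun j => (i.removeNth v j).2) := by
  rw [contractFst, exteriorPower.alternatingMapLinearEquiv_apply_ιMulti,
    AlternatingMap.alternatizeUncurryFin_apply]
  rfl

/-- Contracting `e ∧ v₁ ∧ ⋯ ∧ v_m`, where `e = (1, 0)` and the `v_i` lie in `Q`, against the first
coordinate returns `v₁ ∧ ⋯ ∧ v_m`. -/
theorem exteriorPower.subsingleton_of_subsingleton_prod {m : ℕ}
    [Subsingleton (⋀[S]^(m + 1) (S × Q))] : Subsingleton (⋀[S]^m Q) := by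
  rw [← Submodule.subsingleton_iff S, ← subsingleton_iff_bot_eq_top, ← exteriorPower.ιMulti_span,
    eq_comm, Submodule.span_eq_bot]
  rintro _ ⟨v, rfl⟩
  have h : exteriorPower.ιMulti S (m + 1)
      (Fin.cons ((1, 0) : S × Q) fun i => ((0, v i) : S × Q)) = 0 :=
    Subsingleton.elim _ _
  have h2 := congrArg (exteriorPower.contractFst S Q m) h
  rw [contractFst_ιMulti, map_zero, Fin.sum_univ_succ] at h2
  simpa using h2

/-- If `⋀² Q = 0`, then `⋀² (S ⊕ Q) ≃ Q`. -/
noncomputable def exteriorPower.twoProdEquiv [Subsingleton (⋀[S]^2 Q)] : ⋀[S]^2 (S × Q) ≃ₗ[S] Q :=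
  -- `F` sends `v ∧ w` to `v.1 • w.2 - w.1 • v.2`, and `G` sends `q` to `(1, 0) ∧ q`. That `G ∘ F`
  -- is the identity is `ExteriorAlgebra.ι_prod_mul_ι_prod`.
  let F : ⋀[S]^2 (S × Q) →ₗ[S] Q :=
    (exteriorPower.oneEquiv S Q).toLinearMap ∘ₗ exteriorPower.contractFst S Q 1
  let G : Q →ₗ[S] ⋀[S]^2 (S × Q) :=
    ((exteriorPower.ιMulti S 2 (M := S × Q)).toMultilinearMap.toLinearMap ![(1, 0), 0] 1) ∘ₗ
      LinearMap.inr S S Q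
  have hF (v : Fin 2 → S × Q) : F (exteriorPower.ιMulti S 2 v) =
      (v 0).1 • (v 1).2 - (v 1).1 • (v 0).2 := by
    simp only [F, LinearMap.comp_apply, contractFst_ιMulti, LinearEquiv.coe_coe]
    simp [Fin.sum_univ_two, Fin.removeNth_apply, sub_eq_add_neg]
  have hG (q : Q) : G q = exteriorPower.ιMulti S 2 ![(1, 0), (0, q)] := by
    simp only [G, LinearMap.comp_apply, MultilinearMap.toLinearMap_apply, LinearMap.inr_apply]
    refine congrArg (exteriorPower.ιMulti S 2) (funext fun i => ?_)
    fin_cases i <;> rfl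
  LinearEquiv.ofLinearMap F G
    (by ext q; simp [hG, hF])
    (by
      refine exteriorPower.linearMap_ext (AlternatingMap.ext fun v => ?_)
      apply Subtype.ext
      simp only [LinearMap.compAlternatingMap_apply, LinearMap.comp_apply, hF, hG,
        LinearMap.id_apply, exteriorPower.ιMulti_apply_coe, ExteriorAlgebra.ιMulti_apply]
      simp [ExteriorAlgebra.ι_prod_mul_ι_prod (v 0) (v 1)])

end ExteriorProd

/-! ### Modules that are cyclic modulo every maximal ideal -/

section CyclicModulo

variable {S N : Type*} [CommRing S] [AddCommGroup N] [Module S N]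

/-- The second exterior power of `N/MN` over `S/M` is a quotient of `⋀² N`, hence zero. Its
dimension is `d` choose 2 for `d = dim N/MN`, so `d ≤ 1`. -/
theorem exists_span_singleton_sup_smul_top_of_subsingleton [Module.Finite S N]
    [Subsingleton (⋀[S]^2 N)] (M : Ideal S) [M.IsMaximal] :
    ∃ n₀ : N, (⊤ : Submodule S N) ≤ Submodule.span S {n₀} ⊔ M • ⊤ := by
  let := Ideal.Quotient.field M
  let V := N ⧸ (M • ⊤ : Submodule S N)
  have hV : Module.Finite (S ⧸ M) V := Module.Finite.of_restrictScalars_finite S _ _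
  have hsub : Subsingleton (⋀[S ⧸ M]^2 V) :=
    (exteriorPower.mapRestrict_surjective (S := S ⧸ M) 2
      (Submodule.mkQ_surjective (M • ⊤ : Submodule S N)) Ideal.Quotient.mk_surjective).subsingleton
  have h2 : Module.finrank (S ⧸ M) (⋀[S ⧸ M]^2 V) = 0 := Module.finrank_zero_of_subsingleton
  rw [exteriorPower.finrank_eq, Nat.choose_eq_zero_iff] at h2
  obtain ⟨v, hv⟩ := finrank_le_one_iff.1 (Nat.lt_succ_iff.1 h2)
  obtain ⟨n₀, rfl⟩ := Submodule.mkQ_surjective _ v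
  refine ⟨n₀, fun n _ => ?_⟩
  obtain ⟨c, hc⟩ := hv (Submodule.mkQ _ n)
  obtain ⟨s, rfl⟩ := Ideal.Quotient.mk_surjective c
  have h3 : Submodule.mkQ (M • ⊤ : Submodule S N) (n - s • n₀) = 0 := by
    rw [map_sub, map_smul, sub_eq_zero]; exact hc.symm
  rw [Submodule.mkQ_apply, Submodule.Quotient.mk_eq_zero] at h3
  rw [← add_sub_cancel (s • n₀) n]
  exact Submodule.add_mem_sup
    (Submodule.smul_mem _ _ (Submodule.mem_span_singleton_self n₀)) h3

/-- As `n₀ ∧ n₀ = 0`, expanding a product of two elements of `S n₀ + MN` gives `⋀² N = M ⋀² N`.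
Nakayama at every `M` finishes. -/
theorem exteriorPower.subsingleton_two_of_forall_isMaximal [Module.Finite S N]
    (h : ∀ (M : Ideal S), M.IsMaximal →
      ∃ n₀ : N, (⊤ : Submodule S N) ≤ Submodule.span S {n₀} ⊔ M • ⊤) :
    Subsingleton (⋀[S]^2 N) := by
  have hle : ∀ (M : Ideal S), M.IsMaximal →
      (⊤ : Submodule S (⋀[S]^2 N)) ≤ M • ⊤ := by
    intro M hM
    obtain ⟨n₀, hn₀⟩ := h M hM
    suffices hspan : Submodule.span S (Set.range (exteriorPower.ιMulti S 2 (M := N))) ≤ M • ⊤ by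
      rwa [exteriorPower.ιMulti_span] at hspan
    rw [Submodule.span_le]
    rintro _ ⟨v, rfl⟩
    have hmem (k : N) (hk : k ∈ (M • ⊤ : Submodule S N)) (w : Fin 2 → N) (i : Fin 2) :
        exteriorPower.ιMulti S 2 (Function.update w i k) ∈ (M • ⊤ : Submodule S (⋀[S]^2 N)) := by
      have h1 : Submodule.map
          ((exteriorPower.ιMulti S 2 (M := N)).toMultilinearMap.toLinearMap w i)
          (M • ⊤) ≤ M • ⊤ := by
        rw [Submodule.map_smul'']
        exact Submodule.smul_mono le_rfl le_top
      exact h1 ⟨k, hk, rfl⟩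
    have hdec (n : N) : ∃ (s : S) (k : N), k ∈ (M • ⊤ : Submodule S N) ∧ n = s • n₀ + k := by
      obtain ⟨y, hy, k, hk, rfl⟩ := Submodule.mem_sup.1 (hn₀ (Submodule.mem_top (x := n)))
      obtain ⟨s, rfl⟩ := Submodule.mem_span_singleton.1 hy
      exact ⟨s, k, hk, rfl⟩
    obtain ⟨s, k, hk, hs⟩ := hdec (v 0)
    obtain ⟨t, l, hl, ht⟩ := hdec (v 1)
    have hv : v = Function.update (Function.update v 1 (t • n₀ + l)) 0 (s • n₀ + k) := by
      ext i; fin_cases i <;> simp [hs, ht]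
    rw [SetLike.mem_coe, hv, AlternatingMap.map_update_add]
    refine add_mem ?_ (hmem k hk _ _)
    rw [Function.update_comm (by decide), AlternatingMap.map_update_add]
    refine add_mem ?_ (hmem l hl _ _)
    rw [AlternatingMap.map_update_smul, Function.update_comm (by decide),
      AlternatingMap.map_update_smul,
      AlternatingMap.map_eq_zero_of_eq _ _ (i := 0) (j := 1) (by simp) (by decide)]
    simp
  -- Nakayama yields an annihilating element congruent to `1` modulo `M`, so no maximal ideal
  -- contains the annihilator.
  have hann : (⊤ : Submodule S (⋀[S]^2 N)).annihilator = ⊤ := by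
    by_contra hne
    obtain ⟨M, hM, hleM⟩ := Ideal.exists_le_maximal _ hne
    obtain ⟨r, hr1, hr⟩ := Submodule.exists_sub_one_mem_and_smul_eq_zero_of_fg_of_le_smul M
      (⊤ : Submodule S (⋀[S]^2 N)) Module.Finite.fg_top (hle M hM)
    have hrM : r ∈ M := hleM (Submodule.mem_annihilator.2 hr)
    exact hM.ne_top ((Ideal.eq_top_iff_one M).2 (by simpa using M.sub_mem hrM hr1))
  rw [Submodule.annihilator_eq_top_iff] at hann
  exact (Submodule.subsingleton_iff S).1 (subsingleton_of_bot_eq_top hann.symm)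

theorem exteriorPower.subsingleton_of_two_le [Subsingleton (⋀[S]^2 N)] {m : ℕ} (hm : 2 ≤ m) :
    Subsingleton (⋀[S]^m N) := by
  obtain ⟨k, rfl⟩ := Nat.exists_eq_add_of_le hm
  rw [← Submodule.subsingleton_iff S, ← subsingleton_iff_bot_eq_top, ← exteriorPower.ιMulti_span,
    eq_comm, Submodule.span_eq_bot]
  rintro _ ⟨v, rfl⟩
  apply Subtype.ext
  rw [exteriorPower.ιMulti_apply_coe, ExteriorAlgebra.ιMulti_apply, List.ofFn_add, List.prod_append]
  have h : (List.ofFn fun i : Fin 2 => ExteriorAlgebra.ι S (v (i.castLE (by omega)))).prod = 0 := by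
    simp only [List.ofFn_succ, List.ofFn_zero, List.prod_cons, List.prod_nil, mul_one]
    exact ExteriorAlgebra.ι_mul_ι_eq_zero_of_subsingleton _ _
  exact (congrArg (· * _) h).trans (zero_mul _)

end CyclicModulo

/-! ### Cotangent spaces and Kähler differentials over a perfect field -/

section Cotangent

variable {K S : Type*} [Field K] [PerfectField K] [CommRing S] [Algebra K S] [Module.Finite K S]

/-- The kernel of `P/(ker f)² → A` has square zero, so formal smoothness lifts the identity of `A`.
-/
theorem Algebra.FormallySmooth.exists_kerSquareLift_comp_eq_id {R P A : Type*} [CommRing R]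
    [CommRing P] [CommRing A] [Algebra R P] [Algebra R A] [Algebra.FormallySmooth R A]
    (f : P →ₐ[R] A) (hf : Function.Surjective f) :
    ∃ g : A →ₐ[R] P ⧸ RingHom.ker f.toRingHom ^ 2, f.kerSquareLift.comp g = AlgHom.id R A := by
  have surj : Function.Surjective f.kerSquareLift :=
    Ideal.Quotient.lift_surjective_of_surjective _ _ hf
  have sqz : RingHom.ker f.kerSquareLift.toRingHom ^ 2 = ⊥ := by
    rw [AlgHom.ker_kerSquareLift, Ideal.cotangentIdeal_square]
  exact ⟨Algebra.FormallySmooth.liftOfSurjective (AlgHom.id R A) f.kerSquareLift surj ⟨2, sqz⟩,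
    Algebra.FormallySmooth.comp_liftOfSurjective _ _ _ _⟩

open KaehlerDifferential in
-- The residue field is formally smooth over the perfect field `K`; the resulting section modulo
-- `M²` gives a retraction of the conormal map.
theorem kerCotangentToTensor_quotient_injective (M : Ideal S) [M.IsMaximal] :
    Function.Injective (kerCotangentToTensor K S (S ⧸ M)) := by
  have hs : Algebra.FormallySmooth K (S ⧸ M) := by
    let := Ideal.Quotient.field M
    infer_instance
  obtain ⟨l, hl⟩ := (retractionKerCotangentToTensorEquivSection
    (R := K) (P := S) (S := S ⧸ M) Ideal.Quotient.mk_surjective).symm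
    ⟨_, (Algebra.FormallySmooth.exists_kerSquareLift_comp_eq_id
      (IsScalarTower.toAlgHom K S (S ⧸ M)) Ideal.Quotient.mk_surjective).choose_spec⟩
  exact Function.LeftInverse.injective (g := l) fun x => LinearMap.congr_fun hl x

open KaehlerDifferential in
-- The cokernel is the module of differentials of the residue field, which vanishes as `S/M` is
-- separable over `K`.
theorem kerCotangentToTensor_quotient_surjective (M : Ideal S) [M.IsMaximal] :
    Function.Surjective (kerCotangentToTensor K S (S ⧸ M)) := by
  let := Ideal.Quotient.field M
  have : Algebra.IsSeparable K (S ⧸ M) := inferInstance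
  have : Algebra.FormallyUnramified K (S ⧸ M) := Algebra.FormallyUnramified.of_isSeparable K _
  have : Subsingleton (Ω[(S ⧸ M)⁄K]) := inferInstance
  intro x
  exact (exact_kerCotangentToTensor_mapBaseChange K S (S ⧸ M) Ideal.Quotient.mk_surjective x).1
    (Subsingleton.elim _ _)

theorem one_tmul_eq_zero_iff_mem_smul_top {N : Type*} [AddCommGroup N] [Module S N] (M : Ideal S)
    (n : N) : (1 : S ⧸ M) ⊗ₜ[S] n = 0 ↔ n ∈ (M • ⊤ : Submodule S N) := by
  rw [← (TensorProduct.quotTensorEquivQuotSMul N M).map_eq_zero_iff,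
    ← map_one (Ideal.Quotient.mk M), TensorProduct.quotTensorEquivQuotSMul_mk_tmul, one_smul]
  exact Submodule.Quotient.mk_eq_zero _

open KaehlerDifferential in
-- The map `m ↦ dm` induces an isomorphism `M/M² ≅ Ω/MΩ`, and the two sides say that source and
-- target have dimension at most one over `S/M`.
theorem exists_span_sup_sq_iff_exists_span_kaehlerDifferential (M : Ideal S) [M.IsMaximal] :
    (∃ a ∈ M, M ≤ Ideal.span {a} ⊔ M ^ 2) ↔
      ∃ n₀ : Ω[S⁄K], (⊤ : Submodule S (Ω[S⁄K])) ≤ Submodule.span S {n₀} ⊔ M • ⊤ := by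
  let := Ideal.Quotient.field M
  have hk : RingHom.ker (algebraMap S (S ⧸ M)) = M := Ideal.mk_ker
  have hk2 : RingHom.ker (algebraMap S (S ⧸ M)) ^ 2 = M ^ 2 := congrArg (· ^ 2) hk
  have hcot (m : S) (hm : m ∈ M) : kerCotangentToTensor K S (S ⧸ M)
      (Ideal.toCotangent _ ⟨m, hk.symm ▸ hm⟩) = 1 ⊗ₜ D K S m := rfl
  have hcot0 (m : S) (hm : m ∈ M) (h0 : (1 : S ⧸ M) ⊗ₜ[S] D K S m = 0) : m ∈ M ^ 2 := by
    rw [← hcot m hm, ← map_zero (kerCotangentToTensor K S (S ⧸ M))] at h0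
    have := kerCotangentToTensor_quotient_injective M h0
    exact hk2.le ((Ideal.toCotangent_eq_zero _ _).1 this)
  have hsq (m : S) (hm : m ∈ M ^ 2) : D K S m ∈ (M • ⊤ : Submodule S (Ω[S⁄K])) := by
    rw [← one_tmul_eq_zero_iff_mem_smul_top, ← hcot m (Ideal.pow_le_self two_ne_zero hm)]
    rw [(Ideal.toCotangent_eq_zero _ _).2 (hk2.ge hm), map_zero]
  constructor
  · rintro ⟨a, ha, hM⟩
    refine ⟨D K S a, fun n _ => ?_⟩
    obtain ⟨x, hx⟩ := kerCotangentToTensor_quotient_surjective (K := K) M (1 ⊗ₜ n)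
    obtain ⟨⟨m, hm⟩, rfl⟩ := Ideal.toCotangent_surjective _ x
    rw [hk] at hm
    rw [hcot m hm] at hx
    have h1 : n - D K S m ∈ (M • ⊤ : Submodule S (Ω[S⁄K])) := by
      rw [← one_tmul_eq_zero_iff_mem_smul_top, TensorProduct.tmul_sub, hx, sub_self]
    obtain ⟨y, hy, μ, hμ, rfl⟩ := Submodule.mem_sup.1 (hM hm)
    obtain ⟨c, rfl⟩ := Ideal.mem_span_singleton'.1 hy
    rw [map_add, Derivation.leibniz] at h1
    have h2 : n = c • D K S a + (a • D K S c + D K S μ +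
      (n - (c • D K S a + a • D K S c + D K S μ))) := by abel
    rw [h2]
    exact Submodule.add_mem_sup (Submodule.smul_mem _ _ (Submodule.mem_span_singleton_self _))
      (add_mem (add_mem (Submodule.smul_mem_smul ha trivial) (hsq μ hμ)) h1)
  · rintro ⟨n₀, hn₀⟩
    have hgen (n : Ω[S⁄K]) : ∃ s : S, (1 : S ⧸ M) ⊗ₜ[S] n = s • (1 ⊗ₜ n₀) := by
      obtain ⟨y, hy, k, hk, rfl⟩ := Submodule.mem_sup.1 (hn₀ (Submodule.mem_top (x := n)))
      obtain ⟨s, rfl⟩ := Submodule.mem_span_singleton.1 hy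
      refine ⟨s, ?_⟩
      rw [TensorProduct.tmul_add, (one_tmul_eq_zero_iff_mem_smul_top M k).2 hk, add_zero,
        TensorProduct.tmul_smul]
    -- If all differentials of elements of `M` vanish modulo `M`, then `M = M²` and `a = 0` works.
    -- Otherwise any `a` with nonzero differential works.
    by_cases hall : ∀ m ∈ M, (1 : S ⧸ M) ⊗ₜ[S] D K S m = 0
    · exact ⟨0, M.zero_mem, fun m hm => Submodule.mem_sup_right (hcot0 m hm (hall m hm))⟩
    push Not at hall
    obtain ⟨a, ha, hane⟩ := hall
    refine ⟨a, ha, fun m hm => ?_⟩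
    obtain ⟨s, hs⟩ := hgen (D K S a)
    obtain ⟨t, ht⟩ := hgen (D K S m)
    have hsM : Ideal.Quotient.mk M s ≠ 0 := by
      intro h0
      apply hane
      rw [hs, ← algebraMap_smul (S ⧸ M) s]
      change Ideal.Quotient.mk M s • _ = _
      rw [h0, zero_smul]
    -- With `da ≡ s n₀` and `dm ≡ t n₀`, this `c` makes the differential of `m - c a` vanish modulo
    -- `M`.
    obtain ⟨c, hc⟩ := Ideal.Quotient.mk_surjective (Ideal.Quotient.mk M t / Ideal.Quotient.mk M s)
    have h1 : m - c * a ∈ M ^ 2 := by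
      refine hcot0 _ (M.sub_mem hm (M.mul_mem_left _ ha)) ?_
      have haD : (1 : S ⧸ M) ⊗ₜ[S] (a • D K S c) = 0 :=
        (one_tmul_eq_zero_iff_mem_smul_top M _).2 (Submodule.smul_mem_smul ha trivial)
      rw [map_sub, Derivation.leibniz, TensorProduct.tmul_sub, TensorProduct.tmul_add, haD,
        TensorProduct.tmul_smul, hs, ht, add_zero, smul_smul]
      refine sub_eq_zero.2 ?_
      rw [← algebraMap_smul (S ⧸ M) t, ← algebraMap_smul (S ⧸ M) (c * s)]
      change Ideal.Quotient.mk M t • _ = Ideal.Quotient.mk M (c * s) • _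
      rw [map_mul, hc, div_mul_cancel₀ _ hsM]
    rw [← add_sub_cancel (c * a) m]
    exact Submodule.add_mem_sup (Ideal.mul_mem_left _ _ (Ideal.mem_span_singleton_self a)) h1

end Cotangent

/-- A generator modulo `M²` generates the maximal ideal of the local ring by Nakayama. Conversely, a
local generator can be taken in `S`, and the denominators are invertible modulo `M`. -/
theorem exists_maximalIdeal_eq_span_singleton_iff {S : Type*} [CommRing S] [IsNoetherianRing S]
    (M : Ideal S) [M.IsMaximal] :
    (∃ a : Localization.AtPrime M, IsLocalRing.maximalIdeal (Localization.AtPrime M) =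
      Ideal.span {a}) ↔ ∃ a ∈ M, M ≤ Ideal.span {a} ⊔ M ^ 2 := by
  let T := Localization.AtPrime M
  have hmap : M.map (algebraMap S T) = IsLocalRing.maximalIdeal T :=
    Localization.AtPrime.map_eq_maximalIdeal
  constructor
  · rintro ⟨t, ht⟩
    obtain ⟨a, s, rfl⟩ := IsLocalization.exists_mk'_eq M.primeCompl t
    have hat : IsLocalRing.maximalIdeal T = Ideal.span {algebraMap S T a} := by
      rw [ht]
      rw [← Ideal.span_singleton_mul_right_unit (IsLocalization.map_units T s),
        IsLocalization.mk'_spec]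
    have ha : a ∈ M := by
      rw [← IsLocalization.AtPrime.to_map_mem_maximal_iff T M a, hat]
      exact Ideal.mem_span_singleton_self _
    refine ⟨a, ha, fun b hb => ?_⟩
    have hbt : algebraMap S T b ∈ Ideal.span {algebraMap S T a} := by
      rw [← hat, IsLocalization.AtPrime.to_map_mem_maximal_iff T M b]
      exact hb
    obtain ⟨u, hu⟩ := Ideal.mem_span_singleton'.1 hbt
    obtain ⟨c, s, rfl⟩ := IsLocalization.exists_mk'_eq M.primeCompl u
    rw [← IsLocalization.mk'_one (M := M.primeCompl) T a, ← IsLocalization.mk'_mul, mul_one,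
      IsLocalization.mk'_eq_iff_eq_mul, ← map_mul, IsLocalization.eq_iff_exists M.primeCompl] at hu
    obtain ⟨s', hs'⟩ := hu
    have hsM : (s' : S) * s ∉ M := fun h => (s' * s).2 h
    -- Here `r s' s + i = 1` with `i ∈ M`. Multiplying by `b` leaves a multiple of `a` plus `i b ∈
    -- M²`.
    obtain ⟨r, hr⟩ := Ideal.IsMaximal.exists_inv (I := M) ‹_› hsM
    obtain ⟨i, hi, hri⟩ := hr
    have hb2 : b = (r * s' * c) * a + i * b := by
      linear_combination (-b) * hri - r * hs'
    rw [hb2]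
    exact Submodule.add_mem_sup (Ideal.mul_mem_left _ _ (Ideal.mem_span_singleton_self a))
      (by rw [pow_two]; exact Ideal.mul_mem_mul hi hb)
  · rintro ⟨a, ha, hM⟩
    refine ⟨algebraMap S T a, le_antisymm ?_ ?_⟩
    · refine Submodule.le_of_le_smul_of_le_jacobson_bot (I := IsLocalRing.maximalIdeal T)
        (IsNoetherian.noetherian _) (IsLocalRing.maximalIdeal_le_jacobson _) ?_
      rw [smul_eq_mul, ← pow_two, ← hmap, ← Ideal.map_pow]
      refine (Ideal.map_mono hM).trans ?_
      rw [Ideal.map_sup, Ideal.map_span, Set.image_singleton]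
    · rw [Ideal.span_singleton_le_iff_mem, IsLocalization.AtPrime.to_map_mem_maximal_iff T M a]
      exact ha

/-! ### Weak curvilinearity and smoothness in terms of differentials -/

section Smooth

variable {K S : Type u} [Field K] [CommRing S] [Algebra K S] [Module.Finite K S]

theorem hasWeaklyCurvilinearLocalRings_iff [PerfectField K] :
    HasWeaklyCurvilinearLocalRings S ↔ Subsingleton (⋀[S]^2 (Ω[S⁄K])) := by
  have : IsNoetherianRing S := IsNoetherianRing.of_finite K S
  have : Module.Finite S (Ω[S⁄K]) := inferInstance
  constructor
  · intro h
    refine exteriorPower.subsingleton_two_of_forall_isMaximal fun M hM => ?_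
    rw [← exists_span_sup_sq_iff_exists_span_kaehlerDifferential,
      ← exists_maximalIdeal_eq_span_singleton_iff]
    exact h M
  · intro h M hM
    refine (exists_maximalIdeal_eq_span_singleton_iff M).2 ?_
    rw [exists_span_sup_sq_iff_exists_span_kaehlerDifferential (K := K)]
    exact exists_span_singleton_sup_smul_top_of_subsingleton M

/-- A variable is integral over `K` in `A`, so some nonzero polynomial in it acts as zero on `A`;
flatness makes that polynomial a nonzerodivisor on `A`. -/
theorem MvPolynomial.isEmpty_of_flat_of_isIntegral {σ A : Type*} [CommRing A] [Nontrivial A]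
    [Algebra K A] [Algebra (MvPolynomial σ K) A] [IsScalarTower K (MvPolynomial σ K) A]
    [Module.Flat (MvPolynomial σ K) A] [Algebra.IsIntegral K A] : IsEmpty σ := by
  refine ⟨fun i => ?_⟩
  obtain ⟨p, hp, hpe⟩ := Algebra.IsIntegral.isIntegral (R := K) (algebraMap (MvPolynomial σ K) A (X i))
  rw [← Polynomial.aeval_def, Polynomial.aeval_algebraMap_apply] at hpe
  have hne : Polynomial.aeval (X i : MvPolynomial σ K) p ≠ 0 := by
    intro h0
    have := (MvPolynomial.transcendental_X (R := K) i)
    exact hp.ne_zero (transcendental_iff.1 this p h0)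
  have hreg : IsSMulRegular A (Polynomial.aeval (X i : MvPolynomial σ K) p) :=
    Module.Flat.isSMulRegular_of_isRegular (IsRegular.of_ne_zero hne)
  have : (1 : A) = 0 := by
    apply hreg
    simp only [Algebra.smul_def, hpe, zero_mul]
  exact one_ne_zero this

/-- Locally a smooth algebra is étale over a polynomial ring, and finiteness over `K` leaves no room
for variables. So `S` is locally unramified over `K`. -/
theorem Algebra.Smooth.subsingleton_kaehlerDifferential_of_finite [Algebra.Smooth K S] :
    Subsingleton (Ω[S⁄K]) := by
  have : IsArtinianRing S := IsArtinianRing.of_finite K S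
  refine subsingleton_of_forall_eq 0 fun x => ?_
  by_contra hx
  have hne : Ideal.torsionOf S (Ω[S⁄K]) x ≠ ⊤ := by
    rwa [Ne, Ideal.torsionOf_eq_top_iff]
  obtain ⟨M, hM, hle⟩ := Ideal.exists_le_maximal _ hne
  obtain ⟨f, hf, n, _, _, _⟩ := Algebra.IsSmoothAt.exists_isStandardEtale_mvPolynomial
    (R := K) (S := S) (p := M)
  -- For Artinian `S` a localization is a quotient, so it is again finite over `K`.
  have hsurj : Function.Surjective (algebraMap S (Localization.Away f)) :=
    IsArtinianRing.localization_surjective (Submonoid.powers f) _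
  have : Module.Finite K (Localization.Away f) :=
    Module.Finite.of_surjective (IsScalarTower.toAlgHom K S (Localization.Away f)).toLinearMap hsurj
  have : Nontrivial (Localization.Away f) := by
    refine ⟨1, 0, fun h => ?_⟩
    rw [← map_one (algebraMap S (Localization.Away f)), ← map_zero (algebraMap S _),
      IsLocalization.eq_iff_exists (Submonoid.powers f)] at h
    obtain ⟨⟨_, k, rfl⟩, hk⟩ := h
    rw [mul_one, mul_zero] at hk
    exact hf (hM.isPrime.mem_of_pow_mem k (by rw [show f ^ k = 0 from hk]; exact M.zero_mem))
  have : IsEmpty (Fin n) := MvPolynomial.isEmpty_of_flat_of_isIntegral (K := K)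
    (A := Localization.Away f)
  have : Algebra.FormallyUnramified K (MvPolynomial (Fin n) K) :=
    Algebra.FormallyUnramified.of_equiv (MvPolynomial.isEmptyAlgEquiv K (Fin n)).symm
  have : Algebra.FormallyUnramified K (Localization.Away f) :=
    Algebra.FormallyUnramified.comp K (MvPolynomial (Fin n) K) _
  have h0 : KaehlerDifferential.map K K S (Localization.Away f) x = 0 := Subsingleton.elim _ _
  rw [IsLocalizedModule.eq_zero_iff (Submonoid.powers f)] at h0
  obtain ⟨⟨_, k, rfl⟩, hk⟩ := h0
  exact hf (hM.isPrime.mem_of_pow_mem k (hle hk))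

theorem Algebra.smooth_iff_subsingleton_kaehlerDifferential :
    Algebra.Smooth K S ↔ Subsingleton (Ω[S⁄K]) := by
  constructor
  · intro h
    exact Algebra.Smooth.subsingleton_kaehlerDifferential_of_finite
  · intro h
    have : Algebra.FormallyUnramified K S := ⟨h⟩
    have : Algebra.FormallyEtale K S :=
      Algebra.FormallyEtale.of_formallyUnramified_of_field K S
    have : IsNoetherianRing S := IsNoetherianRing.of_finite K S
    have : Algebra.FinitePresentation K S :=
      Algebra.FinitePresentation.of_finiteType.1 inferInstance
    exact ⟨inferInstance, inferInstance⟩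

end Smooth

theorem eventualValue_eq {f : ℕ → ℤ} {c : ℤ} (h : ∀ᶠ i in Filter.atTop, f i = c) :
    eventualValue f = c := by
  have hex : ∃ c : ℤ, ∀ᶠ i in Filter.atTop, f i = c := ⟨c, h⟩
  rw [eventualValue, dif_pos hex]
  obtain ⟨i, h1, h2⟩ := (hex.choose_spec.and h).exists
  rw [← h1, h2]

/-! ### Stabilization of dimensions under multiplication by `x` -/

section Filtered

variable {K R M : Type*} [Field K] [CommRing R] [Algebra K R] [AddCommGroup M] [Module K M]
  [Module R M] [IsScalarTower K R M]

/-- If `x` maps `C i` onto `C (i + 1)` for large `i`, where the `C i` are finite dimensional and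
span `M`, and if elements of `C i` that are divisible by `x - 1` are `x`-power torsion, then the
dimension of `C i` is for large `i` that of `M / (x - 1) M`. -/
theorem finite_and_eventually_finrank_eq (x : R) (C : ℕ → Submodule K M)
    (hfin : ∀ᶠ i in Filter.atTop, Module.Finite K (C i))
    (hmul : ∀ i, ∀ ω ∈ C i, x • ω ∈ C (i + 1))
    (hsurj : ∀ᶠ i in Filter.atTop, ∀ ω ∈ C (i + 1), ∃ η ∈ C i, x • η = ω)
    (htop : ⨆ i, C i = ⊤)
    (htors : ∀ i, ∀ ω ∈ C i, (∃ η, ω = (x - 1) • η) → ∃ k : ℕ, x ^ k • ω = 0)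
    {V : Type*} [AddCommGroup V] [Module K V] (p : M →ₗ[K] V) (hp : Function.Surjective p)
    (hpx : ∀ η, p (x • η) = p η) (hker : ∀ ω, p ω = 0 → ∃ η, ω = (x - 1) • η) :
    Module.Finite K V ∧ ∀ᶠ i in Filter.atTop, Module.finrank K (C i) = Module.finrank K V := by
  obtain ⟨i₀, hi₀⟩ := Filter.eventually_atTop.1 (hfin.and hsurj)
  have hF (i : ℕ) (hi : i₀ ≤ i) : Module.Finite K (C i) := (hi₀ i hi).1
  let μ (i : ℕ) : C i →ₗ[K] C (i + 1) :=
    ((Algebra.lsmul K K M x).restrict (hmul i))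
  have hμ (i : ℕ) (hi : i₀ ≤ i) : Function.Surjective (μ i) := by
    rintro ⟨ω, hω⟩
    obtain ⟨η, hη, rfl⟩ := (hi₀ i hi).2 ω hω
    exact ⟨⟨η, hη⟩, rfl⟩
  have hd (i : ℕ) (hi : i₀ ≤ i) : Module.finrank K (C (i + 1)) ≤ Module.finrank K (C i) := by
    have := hF i hi
    exact LinearMap.finrank_le_finrank_of_surjective (hμ i hi)
  -- From `i₀` on the dimensions decrease, so they stabilize. The surjections `μ i` are then
  -- injective, which excludes `x`-power torsion in `C i`.
  obtain ⟨i₁, hi₁, hconst⟩ : ∃ i₁, i₀ ≤ i₁ ∧ ∀ i, i₁ ≤ i →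
      Module.finrank K (C (i + 1)) = Module.finrank K (C i) := by
    let d (k : ℕ) := Module.finrank K (C (i₀ + k))
    have hanti : Antitone d := antitone_nat_of_succ_le fun k => hd (i₀ + k) (by omega)
    obtain ⟨n, hn⟩ := WellFoundedGT.monotone_chain_condition
      (α := ℕᵒᵈ) ⟨fun k => OrderDual.toDual (d k), hanti⟩
    have hn' (m : ℕ) (hm : n ≤ m) : d n = d m := hn m hm
    refine ⟨i₀ + n, by omega, fun i hi => ?_⟩
    obtain ⟨k, rfl⟩ := Nat.exists_eq_add_of_le hi
    have h1 := hn' (n + k) (by omega)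
    have h2 := hn' (n + k + 1) (by omega)
    simp only [d] at h1 h2
    rw [add_assoc i₀, ← h1, h2, add_assoc]
  have hinj (i : ℕ) (hi : i₁ ≤ i) : Function.Injective (μ i) := by
    have := hF i (by omega)
    have := hF (i + 1) (by omega)
    exact (LinearMap.injective_iff_surjective_of_finrank_eq_finrank (hconst i hi).symm).2
      (hμ i (by omega))
  have htors' (k : ℕ) : ∀ i, i₁ ≤ i → ∀ ω ∈ C i, x ^ k • ω = 0 → ω = 0 := by
    induction k with
    | zero => intro i _ ω _ h; simpa using h
    | succ k ih =>
      intro i hi ω hω h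
      have h1 : x • ω = 0 := ih (i + 1) (by omega) _ (hmul i ω hω) (by rwa [smul_smul, ← pow_succ])
      have h2 : μ i ⟨ω, hω⟩ = μ i 0 := by
        rw [map_zero]; exact Subtype.ext h1
      exact congrArg Subtype.val (hinj i hi h2)
  -- As `p` does not see multiplication by `x`, the images of the `C i` increase, and from `i₀` on
  -- they are constant. Since the `C i` span `M`, each late one maps onto `V`.
  have hup (i : ℕ) (k : ℕ) : (C i).map p ≤ (C (i + k)).map p := by
    induction k with
    | zero => exact le_rfl
    | succ k ih =>
      refine ih.trans ?_
      rintro _ ⟨ω, hω, rfl⟩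
      exact ⟨x • ω, hmul _ ω hω, hpx ω⟩
  have hdown (i : ℕ) (hi : i₀ ≤ i) (k : ℕ) : (C (i + k)).map p ≤ (C i).map p := by
    induction k with
    | zero => exact le_rfl
    | succ k ih =>
      refine le_trans ?_ ih
      rintro _ ⟨ω, hω, rfl⟩
      obtain ⟨η, hη, rfl⟩ := (hi₀ (i + k) (by omega)).2 ω hω
      exact ⟨η, hη, (hpx η).symm⟩
  have hbij (i : ℕ) (hi : i₁ ≤ i) : Function.Bijective (p ∘ₗ (C i).subtype) := by
    constructor
    · rw [← LinearMap.ker_eq_bot, LinearMap.ker_eq_bot']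
      rintro ⟨ω, hω⟩ h
      obtain ⟨k, hk⟩ := htors i ω hω (hker ω h)
      exact Subtype.ext (htors' k i hi ω hω hk)
    · rw [← LinearMap.range_eq_top, LinearMap.range_comp, Submodule.range_subtype, eq_top_iff,
        ← LinearMap.range_eq_top.2 hp, ← Submodule.map_top, ← htop, Submodule.map_iSup]
      refine iSup_le fun j => (hup j i).trans ?_
      rw [add_comm]
      exact hdown i (by omega) j
  have hequiv (i : ℕ) (hi : i₁ ≤ i) : C i ≃ₗ[K] V := LinearEquiv.ofBijective _ (hbij i hi)
  have := hF i₁ hi₁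
  exact ⟨Module.Finite.equiv (hequiv i₁ le_rfl),
    Filter.eventually_atTop.2 ⟨i₁, fun i hi => (hequiv i hi).finrank_eq⟩⟩

end Filtered

/-! ### Homogeneous polynomials and divisibility by `x₀` in large degree -/

namespace MvPolynomial.IsHomogeneous

/-- Induction principle for homogeneous polynomials. -/
theorem induct {σ R : Type*} [CommSemiring R] {motive : ℕ → MvPolynomial σ R → Prop}
    (C : ∀ a, motive 0 (C a))
    (mul_X : ∀ i j f, f.IsHomogeneous i → motive i f → motive (i + 1) (f * X j))
    (add : ∀ i f g, motive i f → motive i g → motive i (f + g))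
    (zero : ∀ i, motive i 0) {i : ℕ} {f : MvPolynomial σ R} (hf : f.IsHomogeneous i) :
    motive i f := by
  have hmon (d : σ →₀ ℕ) (a : R) : motive d.degree (monomial d a) := by
    have h : ∃ i, (monomial d a).IsHomogeneous i ∧ motive i (monomial d a) :=
      induction_on_monomial (motive := fun p => ∃ i, p.IsHomogeneous i ∧ motive i p)
        (fun a => ⟨0, isHomogeneous_C σ a, C a⟩)
        (fun p j ⟨i, hp, h⟩ => ⟨i + 1, hp.mul (isHomogeneous_X R j), mul_X i j p hp h⟩) d a
    obtain ⟨i, hi, h⟩ := h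
    by_cases h0 : monomial d a = 0
    · rw [h0]; exact zero _
    · rwa [IsHomogeneous.inj_right (isHomogeneous_monomial a rfl) hi h0]
  rw [f.as_sum]
  refine Finset.sum_induction _ (motive i) (add i) (zero i) fun d hd => ?_
  have := hmon d (coeff d f)
  rwa [hf.degree_eq_sum_deg_support hd]

variable {σ K : Type*} [Field K]

theorem mem_span_X_pow {i : ℕ} {f : MvPolynomial σ K} (hf : f.IsHomogeneous i) :
    f ∈ (Ideal.span (Set.range X) : Ideal (MvPolynomial σ K)) ^ i := by
  refine hf.induct (motive := fun i f => f ∈ (Ideal.span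
    (Set.range X) : Ideal (MvPolynomial σ K)) ^ i)
    (fun a => by simp) (fun i j f _ h => ?_) (fun _ _ _ => add_mem) (fun _ => zero_mem _)
  rw [pow_succ]
  exact Ideal.mul_mem_mul h (Ideal.subset_span ⟨j, rfl⟩)

theorem exists_sub_mul_X_mem {I : Ideal (MvPolynomial σ K)}
    (hI : I.IsHomogeneous (homogeneousSubmodule σ K)) {i : ℕ} {f : MvPolynomial σ K}
    (hf : f.IsHomogeneous (i + 1)) {j : σ} (hfI : f ∈ I ⊔ Ideal.span {X j}) :
    ∃ c : MvPolynomial σ K, c.IsHomogeneous i ∧ f - c * X j ∈ I := by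
  obtain ⟨a, ha, b, hb, hab⟩ := Submodule.mem_sup.1 hfI
  obtain ⟨c, rfl⟩ := Ideal.mem_span_singleton'.1 hb
  refine ⟨DirectSum.decompose (homogeneousSubmodule σ K) c i,
    (DirectSum.decompose (homogeneousSubmodule σ K) c i).2, ?_⟩
  have h1 : (DirectSum.decompose (homogeneousSubmodule σ K) f (i + 1) : MvPolynomial σ K) = f :=
    DirectSum.decompose_of_mem_same _ hf
  have h3 := DirectSum.coe_decompose_mul_of_right_mem_of_le (homogeneousSubmodule σ K) (a := c)
    (n := i + 1) (isHomogeneous_X K j) (by omega)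
  rw [Nat.add_sub_cancel] at h3
  rw [← h3, ← h1, ← hab, DirectSum.decompose_add, DirectSum.add_apply, Submodule.coe_add,
    add_sub_cancel_right]
  exact hI (i + 1) ha

end MvPolynomial.IsHomogeneous

namespace ZeroDimProjScheme

variable {K : Type u} [Field K] {n : ℕ} (X : ZeroDimProjScheme K n)

/-- If a prime over `I_X + (X₀)` omitted some variable, its homogeneous core would be a point of the
support on `X₀ = 0`. So the radical of `I_X + (X₀)` contains all variables. -/
theorem exists_span_pow_le : ∃ N : ℕ,
    (Ideal.span (Set.range MvPolynomial.X) : Ideal (MvPolynomial (Fin (n + 1)) K)) ^ N ≤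
      X.vanishingIdeal ⊔ Ideal.span {MvPolynomial.X 0} := by
  refine Ideal.exists_pow_le_of_le_radical_of_fg ?_ ?_
  · rw [Ideal.radical_eq_sInf]
    refine le_sInf fun q ⟨hq, hqp⟩ => ?_
    by_contra hcon
    let 𝒜 := MvPolynomial.homogeneousSubmodule (Fin (n + 1)) K
    have hcore : ¬ HomogeneousIdeal.irrelevant 𝒜 ≤ q.homogeneousCore 𝒜 := by
      intro hle
      apply hcon
      rw [Ideal.span_le]
      rintro _ ⟨j, rfl⟩
      apply Ideal.toIdeal_homogeneousCore_le 𝒜 q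
      apply hle
      exact HomogeneousIdeal.mem_irrelevant_of_mem 𝒜 one_pos (MvPolynomial.isHomogeneous_X K j)
    let p : ProjectiveSpectrum 𝒜 := ⟨q.homogeneousCore 𝒜, hqp.homogeneousCore, hcore⟩
    refine X.avoids_hyperplane p ?_ ?_
    · intro f hf
      have h := Ideal.homogeneousCore_mono 𝒜 (le_sup_left.trans hq)
      apply h
      change f ∈ (X.vanishingIdeal.homogeneousCore 𝒜).toIdeal
      rwa [X.isHomogeneous.toIdeal_homogeneousCore_eq_self]
    · exact Ideal.mem_homogeneousCore_of_homogeneous_of_mem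
        ⟨1, MvPolynomial.isHomogeneous_X K 0⟩
        (hq (Submodule.mem_sup_right (Ideal.mem_span_singleton_self _)))
  · exact Submodule.fg_span (Set.finite_range _)

theorem eventually_exists_x₀_mul_eq : ∀ᶠ i in Filter.atTop,
    ∀ f ∈ X.homogComponent (i + 1), ∃ g ∈ X.homogComponent i, X.x₀ * g = f := by
  obtain ⟨N, hN⟩ := X.exists_span_pow_le
  refine Filter.eventually_atTop.2 ⟨N, fun i hi => ?_⟩
  rintro _ ⟨f, hf, rfl⟩
  obtain ⟨c, hc, hcI⟩ := MvPolynomial.IsHomogeneous.exists_sub_mul_X_mem X.isHomogeneous hf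
    (hN (Ideal.pow_le_pow_right (show N ≤ i + 1 by omega)
      (MvPolynomial.IsHomogeneous.mem_span_X_pow hf)))
  refine ⟨Ideal.Quotient.mk _ c, ⟨c, hc, rfl⟩, ?_⟩
  rw [x₀, mul_comm, ← map_mul]
  exact ((Ideal.Quotient.mk_eq_mk_iff_sub_mem _ _).2 hcI).symm

end ZeroDimProjScheme

/-! ### Graded pieces of a quotient ring and of its differential forms -/

namespace MvPolynomial

variable {σ K R : Type*} [Field K] [CommRing R] [Algebra K R] (π : MvPolynomial σ K →ₐ[K] R)

/-- The image of the homogeneous polynomials of degree `i` in a quotient of a polynomial ring. -/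
noncomputable def imageComponent (i : ℕ) : Submodule K R :=
  (homogeneousSubmodule σ K i).map π.toLinearMap

theorem map_mem_imageComponent {i : ℕ} {f : MvPolynomial σ K} (hf : f.IsHomogeneous i) :
    π f ∈ imageComponent π i :=
  ⟨f, hf, rfl⟩

theorem mul_mem_imageComponent {a b : ℕ} {f g : R} (hf : f ∈ imageComponent π a)
    (hg : g ∈ imageComponent π b) : f * g ∈ imageComponent π (a + b) := by
  obtain ⟨f, hf, rfl⟩ := hf
  obtain ⟨g, hg, rfl⟩ := hg
  exact ⟨f * g, IsHomogeneous.mul hf hg, map_mul π _ _⟩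

theorem one_mem_imageComponent : (1 : R) ∈ imageComponent π 0 :=
  ⟨1, isHomogeneous_one _ K, map_one π⟩

theorem prod_mem_imageComponent {ι : Type*} (s : Finset ι) {b : ι → ℕ} {f : ι → R}
    (hf : ∀ j ∈ s, f j ∈ imageComponent π (b j)) :
    ∏ j ∈ s, f j ∈ imageComponent π (∑ j ∈ s, b j) := by
  classical
  induction s using Finset.induction_on with
  | empty => simpa using one_mem_imageComponent π
  | insert j s hj ih =>
    rw [Finset.prod_insert hj, Finset.sum_insert hj]
    exact mul_mem_imageComponent π (hf j (Finset.mem_insert_self j s))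
      (ih fun k hk => hf k (Finset.mem_insert_of_mem hk))

theorem iSup_imageComponent (hπ : Function.Surjective π) : ⨆ i, imageComponent π i = ⊤ := by
  rw [eq_top_iff]
  rintro f -
  obtain ⟨f, rfl⟩ := hπ f
  rw [← f.sum_homogeneousComponent, map_sum]
  exact sum_mem fun i _ => Submodule.mem_iSup_of_mem i
    (map_mem_imageComponent π (homogeneousComponent_isHomogeneous i f))

instance finite_imageComponent [Fintype σ] (i : ℕ) : Module.Finite K (imageComponent π i) := by
  have : Module.Finite K (homogeneousSubmodule σ K i) :=
    Module.Finite.iff_fg.2 (homogeneousSubmodule_fg _ _ i)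
  exact Module.Finite.map _ _

theorem D_apply_eq_sum [Fintype σ] (f : MvPolynomial σ K) :
    KaehlerDifferential.D K R (π f) =
      ∑ k, π (pderiv k f) • KaehlerDifferential.D K R (π (X k)) := by
  classical
  induction f using MvPolynomial.induction_on with
  | C a =>
    have h : π (C a) = algebraMap K R a := π.commutes a
    rw [h, Derivation.map_algebraMap]
    simp
  | add f g hf hg => simp only [map_add, add_smul, Finset.sum_add_distrib, hf, hg]
  | mul_X f j hf =>
    rw [map_mul, Derivation.leibniz, hf]
    simp only [Derivation.leibniz, map_add, smul_eq_mul, map_mul, add_smul,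
      Finset.sum_add_distrib, pderiv_X, Finset.smul_sum, mul_smul]
    congr 1
    rw [Finset.sum_eq_single j]
    · simp
    · intro k _ hk
      simp [hk.symm]
    · simp

/-- The `K`-span of the forms `f dg₁ ∧ ⋯ ∧ dg_m` of degree `i`. -/
noncomputable def imageForms (m i : ℕ) : Submodule K (⋀[R]^m (Ω[R⁄K])) :=
  Submodule.span K
    {ω | ∃ (a : ℕ) (b : Fin m → ℕ) (f : R) (g : Fin m → R),
      f ∈ imageComponent π a ∧ (∀ j, g j ∈ imageComponent π (b j)) ∧ a + ∑ j, b j = i ∧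
      ω = f • exteriorPower.ιMulti R m (fun j => KaehlerDifferential.D K R (g j))}

/-- The form `dx_{r 0} ∧ ⋯ ∧ dx_{r (m - 1)}`. -/
noncomputable def genForm (m : ℕ) (r : Fin m → σ) : ⋀[R]^m (Ω[R⁄K]) :=
  exteriorPower.ιMulti R m fun j => KaehlerDifferential.D K R (π (X (r j)))

/-- The forms of degree `i` of the shape `f dx_{r 0} ∧ ⋯ ∧ dx_{r (m - 1)}`. -/
noncomputable def genComponent (m i : ℕ) (r : Fin m → σ) : Submodule K (⋀[R]^m (Ω[R⁄K])) :=
  (imageComponent π (i - m)).map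
    ((LinearMap.toSpanSingleton R _ (genForm π m r)).restrictScalars K)

theorem smul_ιMulti_mem_imageForms {m i a : ℕ} {b : Fin m → ℕ} {f : R}
    {g : Fin m → R} (hf : f ∈ imageComponent π a)
    (hg : ∀ j, g j ∈ imageComponent π (b j)) (hi : a + ∑ j, b j = i) :
    f • exteriorPower.ιMulti R m
      (fun j => KaehlerDifferential.D K R (g j)) ∈ imageForms π m i :=
  Submodule.subset_span ⟨a, b, f, g, hf, hg, hi, rfl⟩

theorem genComponent_le (m i : ℕ) (hi : m ≤ i) (r : Fin m → σ) :
    genComponent π m i r ≤ imageForms π m i := by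
  rintro _ ⟨f, hf, rfl⟩
  exact smul_ιMulti_mem_imageForms π hf (b := fun _ => 1)
    (fun j => map_mem_imageComponent π (isHomogeneous_X K (r j))) (by simp; omega)

/-- The chain rule expands each `dg_j` in the `dx_k` with coefficients of degree one less. Thus
forms inherit finiteness and divisibility by `x` from the components of `R`. -/
theorem imageForms_eq_iSup [Fintype σ] (m i : ℕ) (hi : m ≤ i) :
    imageForms π m i = ⨆ r, genComponent π m i r := by
  classical
  refine le_antisymm ?_ (iSup_le fun r => genComponent_le π m i hi r)
  refine Submodule.span_le.2 ?_
  rintro _ ⟨a, b, f, g, hf, hg, hi', rfl⟩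
  choose g' hg' hgg using hg
  -- Degree zero is split off because `b j - 1` truncates there; such a `g j` is constant and `d (g
  -- j) = 0`.
  by_cases hb : ∃ j, b j = 0
  · obtain ⟨j, hj⟩ := hb
    have h0 : KaehlerDifferential.D K R (g j) = 0 := by
      have h1 : (g' j).IsHomogeneous 0 := hj ▸ hg' j
      rw [← hgg j, totalDegree_eq_zero_iff_eq_C.1 ((totalDegree_zero_iff_isHomogeneous σ).2 h1)]
      change KaehlerDifferential.D K R (π (C _)) = 0
      rw [show π (C (coeff 0 (g' j))) = algebraMap K R _ from π.commutes _]
      exact Derivation.map_algebraMap _ _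
    have h2 : exteriorPower.ιMulti R m (fun j => KaehlerDifferential.D K R (g j)) = 0 :=
      (exteriorPower.ιMulti R m).toMultilinearMap.map_coord_zero j h0
    rw [h2, smul_zero]
    exact zero_mem _
  push Not at hb
  have hD (j : Fin m) : KaehlerDifferential.D K R (g j) =
      ∑ k, π (pderiv k (g' j)) • KaehlerDifferential.D K R (π (X k)) := by
    rw [← D_apply_eq_sum, ← hgg j]
    rfl
  have h3 : exteriorPower.ιMulti R m (fun j => KaehlerDifferential.D K R (g j)) =
      ∑ r : Fin m → σ, (∏ j, π (pderiv (r j) (g' j))) • genForm π m r := by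
    simp only [hD]
    refine ((exteriorPower.ιMulti R m (M := Ω[R⁄K])).toMultilinearMap.map_sum
      (fun (j : Fin m) (k : σ) => π (pderiv k (g' j)) •
        KaehlerDifferential.D K R (π (X k)))).trans (Finset.sum_congr rfl fun r _ => ?_)
    exact MultilinearMap.map_smul_univ _ _ _
  rw [SetLike.mem_coe, h3, Finset.smul_sum]
  refine sum_mem fun r _ => Submodule.mem_iSup_of_mem r ?_
  refine ⟨f * ∏ j, π (pderiv (r j) (g' j)), ?_, by simp [mul_smul]⟩
  have h4 := mul_mem_imageComponent π hf (prod_mem_imageComponent π Finset.univ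
    fun j _ => map_mem_imageComponent π (IsHomogeneous.pderiv (i := r j) (hg' j)))
  have h5 : ∑ j, b j = ∑ j, (b j - 1) + m := by
    have : ∑ j, b j = ∑ j, ((b j - 1) + 1) :=
      Finset.sum_congr rfl fun j _ => (Nat.sub_add_cancel (Nat.pos_of_ne_zero (hb j))).symm
    rw [this, Finset.sum_add_distrib]
    simp
  have h6 : a + ∑ j, (b j - 1) = i - m := by omega
  rw [← h6]
  exact h4

theorem finite_imageForms [Fintype σ] (m i : ℕ) (hi : m ≤ i) : Module.Finite K (imageForms π m i) := by
  rw [imageForms_eq_iSup π m i hi]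
  have (r : Fin m → σ) : Module.Finite K (genComponent π m i r) :=
    Module.Finite.map _ _
  exact Submodule.finite_iSup _

theorem X_smul_mem_imageForms (o : σ) (m i : ℕ) {ω : ⋀[R]^m (Ω[R⁄K])}
    (hω : ω ∈ imageForms π m i) : π (X o) • ω ∈ imageForms π m (i + 1) := by
  induction hω using Submodule.span_induction with
  | mem ω hω =>
    obtain ⟨a, b, f, g, hf, hg, hi, rfl⟩ := hω
    rw [smul_smul]
    exact smul_ιMulti_mem_imageForms π
      (mul_mem_imageComponent π (map_mem_imageComponent π (isHomogeneous_X K o)) hf) hg (by omega)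
  | zero => rw [smul_zero]; exact zero_mem _
  | add ω η _ _ h1 h2 => rw [smul_add]; exact add_mem h1 h2
  | smul c ω _ h => rw [smul_comm]; exact Submodule.smul_mem _ c h

theorem eventually_exists_X_smul_eq [Fintype σ] {o : σ} (ho : ∀ᶠ i in Filter.atTop,
      ∀ f ∈ imageComponent π (i + 1), ∃ g ∈ imageComponent π i, π (X o) * g = f) (m : ℕ) :
    ∀ᶠ i in Filter.atTop, ∀ ω ∈ imageForms π m (i + 1),
      ∃ η ∈ imageForms π m i, π (X o) • η = ω := by
  obtain ⟨N, hN⟩ := Filter.eventually_atTop.1 ho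
  refine Filter.eventually_atTop.2 ⟨N + m, fun i hi ω hω => ?_⟩
  rw [imageForms_eq_iSup π m (i + 1) (by omega)] at hω
  induction hω using Submodule.iSup_induction' with
  | mem r ω hω =>
    obtain ⟨f, hf, rfl⟩ := hω
    obtain ⟨g, hg, rfl⟩ := hN (i - m) (by omega) f (by
      rwa [show i - m + 1 = i + 1 - m by omega])
    refine ⟨g • genForm π m r, genComponent_le π m i (by omega) r ⟨g, hg, rfl⟩, ?_⟩
    rw [smul_smul]
    rfl
  | zero => exact ⟨0, zero_mem _, smul_zero _⟩
  | add ω η _ _ h1 h2 =>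
    obtain ⟨ω', h1, rfl⟩ := h1
    obtain ⟨η', h2, rfl⟩ := h2
    exact ⟨ω' + η', add_mem h1 h2, smul_add _ _ _⟩

theorem iSup_imageForms (hπ : Function.Surjective π) (m : ℕ) : ⨆ i, imageForms π m i = ⊤ := by
  classical
  have hstep (f : R) (g : Fin m → MvPolynomial σ K) :
      f • exteriorPower.ιMulti R m (fun j => KaehlerDifferential.D K R (π (g j))) ∈
        ⨆ i, imageForms π m i := by
    have hf : f ∈ ⨆ i, imageComponent π i := by rw [iSup_imageComponent π hπ]; trivial
    induction hf using Submodule.iSup_induction' with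
    | zero => rw [zero_smul]; exact zero_mem _
    | add f f' _ _ h1 h2 => rw [add_smul]; exact add_mem h1 h2
    | mem a f hf =>
      have h1 (j : Fin m) : KaehlerDifferential.D K R (π (g j)) =
          ∑ d ∈ (g j).support, KaehlerDifferential.D K R (π (monomial d (coeff d (g j)))) := by
        rw [← map_sum, ← map_sum, ← as_sum]
      simp only [h1]
      have h2 := (exteriorPower.ιMulti R m (M := Ω[R⁄K])).toMultilinearMap.map_sum_finset
        (fun (j : Fin m) (d : σ →₀ ℕ) =>
          KaehlerDifferential.D K R (π (monomial d (coeff d (g j))))) (fun j => (g j).support)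
      rw [AlternatingMap.coe_multilinearMap] at h2
      rw [h2, Finset.smul_sum]
      refine sum_mem fun r _ => Submodule.mem_iSup_of_mem _ (smul_ιMulti_mem_imageForms π hf
        (b := fun j => (r j).degree)
        (fun j => map_mem_imageComponent π (isHomogeneous_monomial _ rfl)) rfl)
  rw [eq_top_iff]
  rintro ω -
  have hω : ω ∈ Submodule.span R (exteriorPower.ιMulti R m '' {a | Set.range a ⊆
      Set.range (KaehlerDifferential.D K R)}) := by
    rw [exteriorPower.ιMulti_span_of_span R m _ (KaehlerDifferential.span_range_derivation K R)]
    trivial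
  induction hω using Submodule.closure_induction with
  | zero => exact zero_mem _
  | add x y _ _ h1 h2 => exact add_mem h1 h2
  | smul_mem f ω hω =>
    obtain ⟨v, hv, rfl⟩ := hω
    choose g hg using fun j => hv ⟨j, rfl⟩
    choose g' hg' using fun j => hπ (g j)
    have h3 := hstep f g'
    simp only [hg', hg] at h3
    exact h3

end MvPolynomial

/-- A `B`-algebra `A`, viewed as an algebra over `R` along a ring homomorphism `R → B`. -/
def RestrictAlong {R B : Type*} [CommRing R] [CommRing B] (_ψ : R →+* B) (A : Type*) : Type _ := A

namespace RestrictAlong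

variable {R B : Type*} [CommRing R] [CommRing B] (ψ : R →+* B) (A : Type*) [Ring A] [Algebra B A]

noncomputable instance : Ring (RestrictAlong ψ A) := inferInstanceAs (Ring A)

noncomputable instance : Algebra B (RestrictAlong ψ A) := inferInstanceAs (Algebra B A)

noncomputable instance : Algebra R (RestrictAlong ψ A) := Algebra.compHom _ ψ

/-- The identity map from `A` to `A` viewed as an algebra along `ψ`. -/
noncomputable def of : A ≃ₐ[B] RestrictAlong ψ A := AlgEquiv.refl

variable {A} in
theorem smul_def (r : R) (a : RestrictAlong ψ A) : r • a = ψ r • a := rfl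

noncomputable instance {K : Type*} [CommRing K] [Algebra K R] : Algebra K (RestrictAlong ψ A) :=
  Algebra.compHom _ (algebraMap K R)

instance {K : Type*} [CommRing K] [Algebra K R] : IsScalarTower K R (RestrictAlong ψ A) :=
  IsScalarTower.of_algebraMap_eq fun _ => rfl

end RestrictAlong

/-! ### Dehomogenization and torsion -/

namespace MvPolynomial

variable {σ K R : Type*} [Field K] [CommRing R] [Algebra K R] {π : MvPolynomial σ K →ₐ[K] R}

theorem exists_derivation_of_forall_ker [Fintype σ] (hπ : Function.Surjective π) {A : Type*}
    [AddCommGroup A] [Module K A] [Module R A] [IsScalarTower K R A] (y : σ → A)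
    (hy : ∀ f, π f = 0 → ∑ j, π (pderiv j f) • y j = 0) :
    ∃ δ : Derivation K R A, ∀ f, δ (π f) = ∑ j, π (pderiv j f) • y j := by
  let L : MvPolynomial σ K →ₗ[K] A := ∑ j,
    ((LinearMap.toSpanSingleton R A (y j)).restrictScalars K) ∘ₗ π.toLinearMap ∘ₗ
      (pderiv j : Derivation K (MvPolynomial σ K) (MvPolynomial σ K)).toLinearMap
  have hL (f : MvPolynomial σ K) : L f = ∑ j, π (pderiv j f) • y j := by
    simp [L, LinearMap.sum_apply]
  let e := π.toLinearMap.quotKerEquivOfSurjective hπ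
  let δ₀ : R →ₗ[K] A := ((LinearMap.ker π.toLinearMap).liftQ L fun f hf => by
    rw [LinearMap.mem_ker, hL]; exact hy f hf) ∘ₗ e.symm.toLinearMap
  have hδ₀ (f : MvPolynomial σ K) : δ₀ (π f) = ∑ j, π (pderiv j f) • y j := by
    rw [← hL]
    have : e.symm (π f) = Submodule.Quotient.mk f := by
      rw [LinearEquiv.symm_apply_eq]; rfl
    simp only [δ₀, LinearMap.comp_apply, LinearEquiv.coe_coe, this]
    rfl
  refine ⟨Derivation.mk' δ₀ fun a b => ?_, hδ₀⟩
  obtain ⟨f, rfl⟩ := hπ a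
  obtain ⟨g, rfl⟩ := hπ b
  rw [← map_mul, hδ₀, hδ₀, hδ₀]
  simp only [Derivation.leibniz, smul_eq_mul, map_add, map_mul, add_smul, mul_smul,
    Finset.sum_add_distrib, Finset.smul_sum]

theorem sum_pderiv_smul_eq_zero_of_isHomogeneous [Fintype σ]
    (hI : (RingHom.ker π).IsHomogeneous (homogeneousSubmodule σ K)) {A : Type*}
    [AddCommGroup A] [Module R A] (y : σ → A)
    (hy : ∀ i f, f.IsHomogeneous i → π f = 0 → ∑ j, π (pderiv j f) • y j = 0)
    (f : MvPolynomial σ K) (hf : π f = 0) : ∑ j, π (pderiv j f) • y j = 0 := by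
  have h1 (i : ℕ) : π (homogeneousComponent i f) = 0 :=
    homogeneousComponent_mem_of_mem hI (RingHom.mem_ker.2 hf) i
  rw [← f.sum_homogeneousComponent]
  simp only [map_sum, Finset.sum_smul]
  rw [Finset.sum_comm]
  exact Finset.sum_eq_zero fun i _ =>
    hy i _ (homogeneousComponent_isHomogeneous i f) (h1 i)

/-- The substitution `X_j ↦ u x_j` multiplies degree `i` by `u ^ i`, and it kills `ker π` because
that ideal is homogeneous. For `u = 1/x` this is `f ↦ f/x ^ i`, which sends `x` to `1`. -/
theorem exists_algHom_of_isHomogeneous_ker (hπ : Function.Surjective π)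
    (hI : (RingHom.ker π).IsHomogeneous (homogeneousSubmodule σ K)) {B : Type*} [CommRing B]
    [Algebra K B] (φ : R →ₐ[K] B) (u : B) :
    ∃ ψ : R →ₐ[K] B, ∀ i, ∀ f ∈ imageComponent π i, ψ f = u ^ i * φ f := by
  let Ψ : MvPolynomial σ K →ₐ[K] B := aeval fun j => u * φ (π (X j))
  have hΨ {i : ℕ} {f : MvPolynomial σ K} (hf : f.IsHomogeneous i) : Ψ f = u ^ i * φ (π f) := by
    refine hf.induct (motive := fun i f => Ψ f = u ^ i * φ (π f)) (fun a => ?_)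
      (fun i j f _ h => ?_) (fun i f g h1 h2 => ?_) (fun i => ?_)
    · rw [← algebraMap_eq, AlgHom.commutes, AlgHom.commutes, AlgHom.commutes, pow_zero, one_mul]
    · rw [map_mul, h, map_mul, map_mul, aeval_X]
      ring
    · rw [map_add, map_add, map_add, h1, h2, mul_add]
    · simp
  have hker (f : MvPolynomial σ K) (hf : π f = 0) : Ψ f = 0 := by
    rw [← f.sum_homogeneousComponent, map_sum]
    refine Finset.sum_eq_zero fun i _ => ?_
    have h1 : π (homogeneousComponent i f) = 0 :=
      homogeneousComponent_mem_of_mem hI (RingHom.mem_ker.2 hf) i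
    rw [hΨ (homogeneousComponent_isHomogeneous i f), h1, map_zero, mul_zero]
  let ψ : R →ₐ[K] B := (Ideal.Quotient.liftₐ (RingHom.ker π) Ψ hker).comp
    (Ideal.quotientKerAlgEquivOfSurjective hπ).symm.toAlgHom
  have hψ (f : MvPolynomial σ K) : ψ (π f) = Ψ f := by
    have : (Ideal.quotientKerAlgEquivOfSurjective hπ).symm (π f) = Ideal.Quotient.mk _ f := by
      rw [AlgEquiv.symm_apply_eq]; rfl
    simp only [ψ, AlgHom.comp_apply]
    erw [this]
    rfl
  refine ⟨ψ, ?_⟩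
  rintro i _ ⟨f, hf, rfl⟩
  exact (hψ f).trans (hΨ hf)

/-- Dehomogenization `ψ` kills `x - 1`, hence `f`; but `ψ f = f/x ^ i`, so `f` vanishes after
inverting `x`. -/
theorem exists_pow_mul_eq_zero_of_mem_imageComponent (hπ : Function.Surjective π)
    (hI : (RingHom.ker π).IsHomogeneous (homogeneousSubmodule σ K)) (o : σ) {i : ℕ} {f : R}
    (hf : f ∈ imageComponent π i) (hfx : ∃ g, f = (π (X o) - 1) * g) :
    ∃ k : ℕ, π (X o) ^ k * f = 0 := by
  let B := Localization.Away (π (X o))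
  let u : B := IsLocalization.Away.invSelf (π (X o))
  have hu : u * algebraMap R B (π (X o)) = 1 := by
    rw [mul_comm]; exact IsLocalization.Away.mul_invSelf _
  obtain ⟨ψ, hψ⟩ := exists_algHom_of_isHomogeneous_ker hπ hI (IsScalarTower.toAlgHom K R B) u
  obtain ⟨g, hg⟩ := hfx
  have hx : ψ (π (X o)) = 1 := by
    rw [hψ 1 _ (map_mem_imageComponent π (isHomogeneous_X K o)), pow_one]
    exact hu
  have h0 : u ^ i * algebraMap R B f = 0 := by
    have h1 := hψ i f hf
    rw [hg, map_mul, map_sub, hx, map_one, sub_self, zero_mul] at h1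
    rw [hg]
    exact h1.symm
  have h2 : algebraMap R B f = 0 := by
    have h3 := congrArg (algebraMap R B (π (X o)) ^ i * ·) h0
    simp only [mul_zero, ← mul_assoc, ← mul_pow] at h3
    rwa [mul_comm _ u, hu, one_pow, one_mul] at h3
  obtain ⟨⟨_, k, rfl⟩, hk⟩ := (IsLocalization.map_eq_zero_iff (Submonoid.powers (π (X o))) B f).1 h2
  exact ⟨k, hk⟩

section Twist

variable {B A : Type*} [CommRing B] [Algebra K B] [Algebra R B] [Ring A]
  [Algebra R A] [Algebra B A] [IsScalarTower R B A]
  (J : ExteriorAlgebra R (Ω[R⁄K]) →ₐ[R] A) {ψ : R →ₐ[K] B} {u : B}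

/-- The rule `f ↦ u ^ i df` in degree `i` satisfies Leibniz once `R` acts on the target through `ψ`,
since `ψ` itself multiplies degree `i` by `u ^ i`. -/
theorem exists_derivation_restrictAlong [Fintype σ] (hπ : Function.Surjective π)
    (hI : (RingHom.ker π).IsHomogeneous (homogeneousSubmodule σ K))
    (hψ : ∀ i, ∀ f ∈ imageComponent π i, ψ f = u ^ i * algebraMap R B f) :
    ∃ δ : Derivation K R (RestrictAlong (ψ : R →+* B) A),
      (∀ i, ∀ f ∈ imageComponent π i, δ f = RestrictAlong.of (ψ : R →+* B) A
        (u ^ i • J (ExteriorAlgebra.ι R (KaehlerDifferential.D K R f)))) ∧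
      ∀ f, δ f ∈ Submodule.map (RestrictAlong.of (ψ : R →+* B) A).toLinearMap (Submodule.span B
        (Set.range fun z => J (ExteriorAlgebra.ι R z))) := by
  let w := RestrictAlong.of (ψ : R →+* B) A
  let ι' (z : Ω[R⁄K]) : A := J (ExteriorAlgebra.ι R z)
  have hι (r : R) (z : Ω[R⁄K]) : ι' (r • z) = algebraMap R B r • ι' z := by
    simp only [ι', map_smul, algebraMap_smul]
  have hι0 : ι' 0 = 0 := by simp only [ι', map_zero]
  let y (j : σ) : RestrictAlong (ψ : R →+* B) A :=
    w (u • ι' (KaehlerDifferential.D K R (π (X j))))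
  have hterm (r : R) (j : σ) :
      r • y j = w (ψ r • u • ι' (KaehlerDifferential.D K R (π (X j)))) := by
    rw [map_smul]; rfl
  have hsum {i : ℕ} {f : MvPolynomial σ K} (hf : f.IsHomogeneous i) :
      ∑ j, π (pderiv j f) • y j = w (u ^ i • ι' (KaehlerDifferential.D K R (π f))) := by
    simp only [hterm]
    rw [← map_sum]
    congr 1
    have hsum' : ι' (∑ k, π (pderiv k f) • KaehlerDifferential.D K R (π (X k))) =
        ∑ k, ι' (π (pderiv k f) • KaehlerDifferential.D K R (π (X k))) := by
      simp only [ι', map_sum]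
    rw [D_apply_eq_sum, hsum', Finset.smul_sum]
    refine Finset.sum_congr rfl fun j _ => ?_
    rw [hι]
    -- The partial derivatives have degree `i - 1`, so constants need separate treatment.
    cases i with
    | zero =>
      rw [totalDegree_eq_zero_iff_eq_C.1 ((totalDegree_zero_iff_isHomogeneous σ).2 hf), pderiv_C]
      simp only [map_zero, zero_smul, smul_zero]
    | succ i =>
      rw [hψ i _ (map_mem_imageComponent π (hf.pderiv (i := j)))]
      simp only [smul_smul]
      congr 1
      ring
  obtain ⟨δ, hδ⟩ := exists_derivation_of_forall_ker hπ y
    (sum_pderiv_smul_eq_zero_of_isHomogeneous hI y fun i f hf h0 => by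
      rw [hsum hf, h0, map_zero, hι0, smul_zero, map_zero])
  refine ⟨δ, ?_, ?_⟩
  · rintro i _ ⟨f, hf, rfl⟩
    exact (hδ f).trans (hsum hf)
  · intro f
    obtain ⟨f, rfl⟩ := hπ f
    rw [hδ]
    refine sum_mem fun j _ => ?_
    rw [hterm]
    exact Submodule.mem_map_of_mem (Submodule.smul_mem _ _ (Submodule.smul_mem _ _
      (Submodule.subset_span ⟨_, rfl⟩)))

theorem exists_algHom_restrictAlong [Fintype σ] (hπ : Function.Surjective π)
    (hI : (RingHom.ker π).IsHomogeneous (homogeneousSubmodule σ K))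
    (hψ : ∀ i, ∀ f ∈ imageComponent π i, ψ f = u ^ i * algebraMap R B f)
    (hJ : ∀ z ∈ Submodule.span B (Set.range fun z => J (ExteriorAlgebra.ι R z)), z * z = 0) :
    ∃ θ : ExteriorAlgebra R (Ω[R⁄K]) →ₐ[R] RestrictAlong (ψ : R →+* B) A,
      ∀ i, ∀ f ∈ imageComponent π i, θ (ExteriorAlgebra.ι R (KaehlerDifferential.D K R f)) =
        RestrictAlong.of (ψ : R →+* B) A
          (u ^ i • J (ExteriorAlgebra.ι R (KaehlerDifferential.D K R f))) := by
  obtain ⟨δ, hδ, hδm⟩ := exists_derivation_restrictAlong J hπ hI hψ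
  have hmem (z : Ω[R⁄K]) : δ.liftKaehlerDifferential z ∈ Submodule.map
      (RestrictAlong.of (ψ : R →+* B) A).toLinearMap (Submodule.span B
        (Set.range fun z => J (ExteriorAlgebra.ι R z))) := by
    have hz : z ∈ Submodule.span R (Set.range (KaehlerDifferential.D K R)) := by
      rw [KaehlerDifferential.span_range_derivation]; trivial
    induction hz using Submodule.span_induction with
    | zero => rw [map_zero]; exact zero_mem _
    | add a b _ _ h1 h2 => rw [map_add]; exact add_mem h1 h2
    | smul r a _ h => rw [map_smul, RestrictAlong.smul_def]; exact Submodule.smul_mem _ _ h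
    | mem a ha =>
      obtain ⟨f, rfl⟩ := ha
      rw [Derivation.liftKaehlerDifferential_comp_D]
      exact hδm f
  have hsq (z : Ω[R⁄K]) :
      δ.liftKaehlerDifferential z * δ.liftKaehlerDifferential z = 0 := by
    obtain ⟨t, ht, htz⟩ := hmem z
    rw [← htz]
    change RestrictAlong.of (ψ : R →+* B) A t * RestrictAlong.of (ψ : R →+* B) A t = 0
    rw [← map_mul, hJ t ht, map_zero]
  refine ⟨ExteriorAlgebra.lift R ⟨δ.liftKaehlerDifferential, hsq⟩, fun i f hf => ?_⟩
  rw [ExteriorAlgebra.lift_ι_apply, Derivation.liftKaehlerDifferential_comp_D]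
  exact hδ i f hf

theorem algHom_restrictAlong_apply_of_mem_imageForms [IsScalarTower K R B]
    (hψ : ∀ i, ∀ f ∈ imageComponent π i, ψ f = u ^ i * algebraMap R B f)
    {θ : ExteriorAlgebra R (Ω[R⁄K]) →ₐ[R] RestrictAlong (ψ : R →+* B) A}
    (hθ : ∀ i, ∀ f ∈ imageComponent π i, θ (ExteriorAlgebra.ι R (KaehlerDifferential.D K R f)) =
        RestrictAlong.of (ψ : R →+* B) A
          (u ^ i • J (ExteriorAlgebra.ι R (KaehlerDifferential.D K R f))))
    {m i : ℕ} {ω : ⋀[R]^m (Ω[R⁄K])} (hω : ω ∈ imageForms π m i) :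
    θ (ω : ExteriorAlgebra R (Ω[R⁄K])) =
      RestrictAlong.of (ψ : R →+* B) A (u ^ i • J (ω : ExteriorAlgebra R (Ω[R⁄K]))) := by
  have hθs (r : R) (a : ⋀[R]^m (Ω[R⁄K])) :
      θ ((r • a : ⋀[R]^m (Ω[R⁄K])) : ExteriorAlgebra R (Ω[R⁄K])) = (ψ : R →+* B) r • θ a := by
    rw [Submodule.coe_smul, map_smul, RestrictAlong.smul_def]
  have hJs (r : R) (a : ⋀[R]^m (Ω[R⁄K])) :
      J ((r • a : ⋀[R]^m (Ω[R⁄K])) : ExteriorAlgebra R (Ω[R⁄K])) = algebraMap R B r • J a := by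
    rw [Submodule.coe_smul, map_smul, algebraMap_smul]
  induction hω using Submodule.span_induction with
  | zero => simp
  | add a b _ _ h1 h2 => rw [Submodule.coe_add, map_add, map_add, smul_add, map_add, h1, h2]
  | smul c a _ h =>
    have hc : (ψ : R →+* B) (algebraMap K R c) = algebraMap R B (algebraMap K R c) :=
      (ψ.commutes c).trans (IsScalarTower.algebraMap_apply K R B c)
    rw [← algebraMap_smul R c a, hθs, hJs, h, hc, ← map_smul, smul_comm]
  | mem ω hω =>
    obtain ⟨a, b, f, g, hf, hg, rfl, rfl⟩ := hω
    have hprod : θ (exteriorPower.ιMulti R m (fun j => KaehlerDifferential.D K R (g j)) :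
        ExteriorAlgebra R (Ω[R⁄K])) = RestrictAlong.of (ψ : R →+* B) A
        (u ^ (∑ j, b j) • J (exteriorPower.ιMulti R m
          (fun j => KaehlerDifferential.D K R (g j)) : ExteriorAlgebra R (Ω[R⁄K]))) := by
      simp only [exteriorPower.ιMulti_apply_coe, ExteriorAlgebra.ιMulti_apply]
      rw [map_list_prod, map_list_prod, List.map_ofFn, List.map_ofFn,
        ← Finset.prod_pow_eq_pow_sum]
      have h2 := (MultilinearMap.mkPiAlgebraFin B m A).map_smul_univ
        (fun j => u ^ b j) (fun j => J (ExteriorAlgebra.ι R (KaehlerDifferential.D K R (g j))))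
      rw [MultilinearMap.mkPiAlgebraFin_apply, MultilinearMap.mkPiAlgebraFin_apply] at h2
      refine Eq.trans ?_ (congrArg (RestrictAlong.of (ψ : R →+* B) A) h2)
      rw [map_list_prod, List.map_ofFn]
      congr 2
      funext j
      exact hθ (b j) (g j) (hg j)
    have hf' : (ψ : R →+* B) f = u ^ a * algebraMap R B f := hψ a f hf
    rw [hθs, hJs, hprod, hf', ← map_smul, smul_smul, smul_smul]
    congr 2
    rw [pow_add]
    ring

end Twist

/-- The argument for functions, on forms: the `ψ`-semilinear map `θ` kills multiples of `x - 1`,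
while on degree `i` it is localization followed by the unit `u ^ i`. -/
theorem exists_pow_smul_eq_zero_of_mem_imageForms [Fintype σ] (hπ : Function.Surjective π)
    (hI : (RingHom.ker π).IsHomogeneous (homogeneousSubmodule σ K)) (o : σ) {m i : ℕ}
    {ω : ⋀[R]^m (Ω[R⁄K])} (hω : ω ∈ imageForms π m i) (hωx : ∃ η, ω = (π (X o) - 1) • η) :
    ∃ k : ℕ, π (X o) ^ k • ω = 0 := by
  let B := Localization.Away (π (X o))
  let u : B := IsLocalization.Away.invSelf (π (X o))
  have hu : u * algebraMap R B (π (X o)) = 1 := by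
    rw [mul_comm]; exact IsLocalization.Away.mul_invSelf _
  obtain ⟨ψ, hψ'⟩ := exists_algHom_of_isHomogeneous_ker hπ hI (IsScalarTower.toAlgHom K R B) u
  have hψ (i : ℕ) (f : R) (hf : f ∈ imageComponent π i) : ψ f = u ^ i * algebraMap R B f :=
    hψ' i f hf
  have hx : ψ (π (X o)) = 1 := by
    rw [hψ 1 _ (map_mem_imageComponent π (isHomogeneous_X K o)), pow_one]
    exact hu
  let J : ExteriorAlgebra R (Ω[R⁄K]) →ₐ[R] B ⊗[R] ExteriorAlgebra R (Ω[R⁄K]) :=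
    Algebra.TensorProduct.includeRight
  have hJ : ∀ z ∈ Submodule.span B (Set.range fun z => J (ExteriorAlgebra.ι R z)), z * z = 0 := by
    have hle : Submodule.span B (Set.range fun z => J (ExteriorAlgebra.ι R z)) ≤
        LinearMap.range ((ExteriorAlgebra.ι R (M := Ω[R⁄K])).baseChange B) := by
      rw [Submodule.span_le]
      rintro _ ⟨z, rfl⟩
      exact ⟨1 ⊗ₜ z, by rw [LinearMap.baseChange_tmul]; rfl⟩
    intro z hz
    obtain ⟨t, rfl⟩ := hle hz
    exact ExteriorAlgebra.baseChange_ι_mul_self t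
  obtain ⟨θ, hθ⟩ := exists_algHom_restrictAlong J hπ hI hψ hJ
  have hθω := algHom_restrictAlong_apply_of_mem_imageForms J hψ hθ hω
  obtain ⟨η, hη⟩ := hωx
  have h0 : u ^ i • J (ω : ExteriorAlgebra R (Ω[R⁄K])) = 0 := by
    apply (RestrictAlong.of (ψ : R →+* B) (B ⊗[R] ExteriorAlgebra R (Ω[R⁄K]))).injective
    rw [← hθω, map_zero, hη, Submodule.coe_smul, map_smul, RestrictAlong.smul_def]
    have h1 : (ψ : R →+* B) (π (X o) - 1) = 0 := by
      rw [map_sub, map_one, sub_eq_zero]; exact hx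
    rw [h1]
    exact zero_smul B (θ (η : ExteriorAlgebra R (Ω[R⁄K])))
  have h1 : J (ω : ExteriorAlgebra R (Ω[R⁄K])) = 0 := by
    have h3 := congrArg (algebraMap R B (π (X o)) ^ i • ·) h0
    simp only [smul_zero, smul_smul, ← mul_pow] at h3
    rwa [mul_comm _ u, hu, one_pow, one_smul] at h3
  have h2 : TensorProduct.mk R B (ExteriorAlgebra R (Ω[R⁄K])) 1 ω = 0 := h1
  rw [IsLocalizedModule.eq_zero_iff (Submonoid.powers (π (X o)))] at h2
  obtain ⟨⟨_, k, rfl⟩, hk⟩ := h2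
  exact ⟨k, Subtype.ext hk⟩

end MvPolynomial

/-! ### Differential forms modulo `x - 1` -/

namespace MvPolynomial

variable {σ K R : Type*} [Field K] [CommRing R] [Algebra K R] {π : MvPolynomial σ K →ₐ[K] R}

/-- The derivation of a graded ring that multiplies forms of degree `i` by `i`, taken modulo
`x - 1` for a form `x` of degree one. -/
theorem exists_eulerDerivation [Fintype σ] (hπ : Function.Surjective π)
    (hI : (RingHom.ker π).IsHomogeneous (homogeneousSubmodule σ K)) (o : σ) :
    ∃ δ : Derivation K R (R ⧸ Ideal.span {π (X o) - 1}), δ (π (X o)) = 1 := by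
  classical
  let mk := Ideal.Quotient.mk (Ideal.span {π (X o) - 1})
  have hsum (f : MvPolynomial σ K) :
      ∑ j, π (pderiv j f) • mk (π (X j)) = mk (π (∑ j, X j * pderiv j f)) := by
    simp only [map_sum, map_mul]
    refine Finset.sum_congr rfl fun j _ => ?_
    rw [mul_comm]
    exact Algebra.smul_def _ _
  obtain ⟨δ, hδ⟩ := exists_derivation_of_forall_ker hπ (fun j => mk (π (X j)))
    -- Euler's formula `∑ X_j ∂f/∂X_j = i f` gives zero on homogeneous relations.
    (sum_pderiv_smul_eq_zero_of_isHomogeneous hI _ fun i f hf h0 => by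
      rw [hsum, hf.sum_X_mul_pderiv, map_nsmul, h0, smul_zero, map_zero])
  refine ⟨δ, ?_⟩
  rw [hδ, hsum, (isHomogeneous_X K o).sum_X_mul_pderiv, one_smul, ← map_one mk]
  exact (Ideal.Quotient.mk_eq_mk_iff_sub_mem _ _).2 (Ideal.mem_span_singleton_self _)

/-- The conormal image for `R → S` is generated by `dx`. The Euler derivation takes `dx` to `1`, so
`dx` spans a free summand and the quotient is `S ⊕ Ω_S`. -/
theorem exists_kaehlerDifferential_prod [Fintype σ] (hπ : Function.Surjective π)
    (hI : (RingHom.ker π).IsHomogeneous (homogeneousSubmodule σ K)) (o : σ) :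
    ∃ p : Ω[R⁄K] →ₗ[R] (R ⧸ Ideal.span {π (X o) - 1}) × Ω[(R ⧸ Ideal.span {π (X o) - 1})⁄K],
      Function.Surjective p ∧ ∀ z, p z = 0 → ∃ z', z = (π (X o) - 1) • z' := by
  obtain ⟨δ, hδ⟩ := exists_eulerDerivation hπ hI o
  let x := π (X o)
  let c := π (X o) - 1
  let S := R ⧸ Ideal.span {c}
  let ρ : Ω[R⁄K] →ₗ[R] S := δ.liftKaehlerDifferential
  let q : Ω[R⁄K] →ₗ[R] Ω[S⁄K] := KaehlerDifferential.map K K R S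
  have hS : Function.Surjective (algebraMap R S) := Ideal.Quotient.mk_surjective
  have hρx : ρ (KaehlerDifferential.D K R x) = 1 := by
    simp only [ρ, Derivation.liftKaehlerDifferential_comp_D, x, hδ]
  have hqx : q (KaehlerDifferential.D K R x) = 0 := by
    have h1 : algebraMap R S x = 1 := by
      rw [← map_one (algebraMap R S)]
      exact (Ideal.Quotient.mk_eq_mk_iff_sub_mem _ _).2 (Ideal.mem_span_singleton_self _)
    simp only [q, KaehlerDifferential.map_D, h1, Derivation.map_one_eq_zero]
  have hqs : Function.Surjective q := KaehlerDifferential.map_surjective_of_surjective K K R S hS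
  refine ⟨ρ.prod q, ?_, ?_⟩
  · rintro ⟨s, w⟩
    obtain ⟨z, rfl⟩ := hqs w
    obtain ⟨r, hr⟩ := hS (s - ρ z)
    refine ⟨z + r • KaehlerDifferential.D K R x, ?_⟩
    have h1 : r • (1 : S) = s - ρ z := by rw [← hr, Algebra.smul_def, mul_one]
    refine Prod.ext ?_ ?_
    · change ρ (z + r • KaehlerDifferential.D K R x) = s
      rw [map_add, map_smul, hρx, h1, add_sub_cancel]
    · change q (z + r • KaehlerDifferential.D K R x) = q z
      rw [map_add, map_smul, hqx, smul_zero, add_zero]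
  · intro z hz
    have hz1 : ρ z = 0 := congrArg Prod.fst hz
    have hz2 : q z = 0 := congrArg Prod.snd hz
    have hcdvd (z : Ω[R⁄K]) (h : (1 : S) ⊗ₜ[R] z = 0) : ∃ z', z = c • z' := by
      rw [one_tmul_eq_zero_iff_mem_smul_top, Submodule.ideal_span_singleton_smul] at h
      obtain ⟨z', -, h'⟩ := (Submodule.mem_smul_pointwise_iff_exists _ _ _).1 h
      exact ⟨z', h'.symm⟩
    have hmb : KaehlerDifferential.mapBaseChange K R S (1 ⊗ₜ z) = 0 := by
      rw [KaehlerDifferential.mapBaseChange_tmul, one_smul]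
      exact hz2
    obtain ⟨t, ht⟩ := (KaehlerDifferential.exact_kerCotangentToTensor_mapBaseChange K R S hS _).1 hmb
    obtain ⟨⟨a, ha⟩, rfl⟩ := Ideal.toCotangent_surjective _ t
    have ha' : a ∈ Ideal.span {c} := by
      have : RingHom.ker (algebraMap R S) = Ideal.span {c} := Ideal.mk_ker
      rwa [this] at ha
    obtain ⟨r, rfl⟩ := Ideal.mem_span_singleton'.1 ha'
    rw [KaehlerDifferential.kerCotangentToTensor_toCotangent] at ht
    obtain ⟨z₁, hz₁⟩ := hcdvd (z - KaehlerDifferential.D K R (r * c)) (by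
      rw [TensorProduct.tmul_sub, ht, sub_self])
    have hDc : KaehlerDifferential.D K R c = KaehlerDifferential.D K R x := by
      simp only [c, map_sub, Derivation.map_one_eq_zero, sub_zero, x]
    rw [Derivation.leibniz, hDc] at hz₁
    have hz₂ : z = r • KaehlerDifferential.D K R x + c • (KaehlerDifferential.D K R r + z₁) := by
      rw [smul_add, ← hz₁]; abel
    have hcS (s : S) : c • s = 0 := by
      have : algebraMap R S c = 0 :=
        Ideal.Quotient.eq_zero_iff_mem.2 (Ideal.mem_span_singleton_self _)
      rw [Algebra.smul_def, this, zero_mul]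
    -- Modulo `c` the form `z` is `r dx`, whose Euler coordinate is the class of `r`; so `c` divides
    -- `r`.
    have hr : algebraMap R S r = 0 := by
      rw [hz₂, map_add, map_smul, map_smul, hcS, add_zero, hρx, Algebra.smul_def, mul_one] at hz1
      exact hz1
    obtain ⟨r', hr'⟩ := Ideal.mem_span_singleton'.1 (Ideal.Quotient.eq_zero_iff_mem.1 hr)
    refine ⟨r' • KaehlerDifferential.D K R x + (KaehlerDifferential.D K R r + z₁), ?_⟩
    rw [hz₂, smul_add c (r' • _), smul_smul, mul_comm c, hr']

theorem finite_and_eventually_finrank_imageComponent [Fintype σ] (hπ : Function.Surjective π)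
    (hI : (RingHom.ker π).IsHomogeneous (homogeneousSubmodule σ K)) {o : σ}
    (ho : ∀ᶠ i in Filter.atTop,
      ∀ f ∈ imageComponent π (i + 1), ∃ g ∈ imageComponent π i, π (X o) * g = f) :
    Module.Finite K (R ⧸ Ideal.span {π (X o) - 1}) ∧ ∀ᶠ i in Filter.atTop,
      Module.finrank K (imageComponent π i) =
        Module.finrank K (R ⧸ Ideal.span {π (X o) - 1}) := by
  refine finite_and_eventually_finrank_eq (R := R) (π (X o)) (imageComponent π)
    (Filter.Eventually.of_forall fun i => inferInstance)
    (fun i f hf => add_comm 1 i ▸ mul_mem_imageComponent π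
      (map_mem_imageComponent π (isHomogeneous_X K o)) hf) ho (iSup_imageComponent π hπ)
    (fun i f hf h => exists_pow_mul_eq_zero_of_mem_imageComponent hπ hI o hf h)
    (Ideal.Quotient.mkₐ K (Ideal.span {π (X o) - 1})).toLinearMap Ideal.Quotient.mk_surjective
    (fun f => ?_) (fun f hf => ?_)
  · refine (Ideal.Quotient.mk_eq_mk_iff_sub_mem _ _).2 (Ideal.mem_span_singleton'.2 ⟨f, ?_⟩)
    rw [smul_eq_mul]
    ring
  · obtain ⟨g, rfl⟩ := Ideal.mem_span_singleton'.1 (Ideal.Quotient.eq_zero_iff_mem.1 hf)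
    exact ⟨g, mul_comm _ _⟩

theorem finite_and_eventually_finrank_imageForms_of_surjective [Fintype σ]
    (hπ : Function.Surjective π)
    (hI : (RingHom.ker π).IsHomogeneous (homogeneousSubmodule σ K)) {o : σ}
    (ho : ∀ᶠ i in Filter.atTop,
      ∀ f ∈ imageComponent π (i + 1), ∃ g ∈ imageComponent π i, π (X o) * g = f) (m : ℕ)
    {S : Type*} [CommRing S] [Algebra R S] [Algebra K S] [IsScalarTower K R S]
    (hS : Function.Surjective (algebraMap R S))
    (hker : RingHom.ker (algebraMap R S) = Ideal.span {π (X o) - 1})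
    {N : Type*} [AddCommGroup N] [Module S N] [Module R N] [IsScalarTower R S N]
    [Module K N] [IsScalarTower K S N] [IsScalarTower K R N]
    (p : Ω[R⁄K] →ₗ[R] N) (hp : Function.Surjective p)
    (hpk : ∀ z, p z = 0 → ∃ z', z = (π (X o) - 1) • z') :
    Module.Finite K (⋀[S]^m N) ∧ ∀ᶠ i in Filter.atTop,
      Module.finrank K (imageForms π m i) = Module.finrank K (⋀[S]^m N) := by
  refine finite_and_eventually_finrank_eq (R := R) (π (X o)) (imageForms π m)
    (Filter.eventually_atTop.2 ⟨m, fun i hi => finite_imageForms π m i hi⟩)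
    (fun i ω hω => X_smul_mem_imageForms π o m i hω) (eventually_exists_X_smul_eq π ho m)
    (iSup_imageForms π hπ m)
    (fun i ω hω h => exists_pow_smul_eq_zero_of_mem_imageForms hπ hI o hω h)
    ((exteriorPower.mapRestrict (S := S) m p).restrictScalars K)
    (exteriorPower.mapRestrict_surjective m hp hS) (fun ω => ?_)
    (fun ω hω => exteriorPower.exists_smul_eq_of_mapRestrict_eq_zero hS hker m hp hpk ω hω)
  have h1 : algebraMap R S (π (X o)) = 1 := by
    have : algebraMap R S (π (X o) - 1) = 0 := by
      rw [← RingHom.mem_ker, hker]; exact Ideal.mem_span_singleton_self _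
    rwa [map_sub, map_one, sub_eq_zero] at this
  rw [LinearMap.restrictScalars_apply, LinearMap.restrictScalars_apply, map_smul,
    ← algebraMap_smul S, h1, one_smul]

theorem finite_and_eventually_finrank_imageForms [Fintype σ] (hπ : Function.Surjective π)
    (hI : (RingHom.ker π).IsHomogeneous (homogeneousSubmodule σ K)) {o : σ}
    (ho : ∀ᶠ i in Filter.atTop,
      ∀ f ∈ imageComponent π (i + 1), ∃ g ∈ imageComponent π i, π (X o) * g = f) (m : ℕ) :
    Module.Finite K (⋀[R ⧸ Ideal.span {π (X o) - 1}]^m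
      ((R ⧸ Ideal.span {π (X o) - 1}) × Ω[(R ⧸ Ideal.span {π (X o) - 1})⁄K])) ∧
    ∀ᶠ i in Filter.atTop, Module.finrank K (imageForms π m i) =
      Module.finrank K (⋀[R ⧸ Ideal.span {π (X o) - 1}]^m
        ((R ⧸ Ideal.span {π (X o) - 1}) × Ω[(R ⧸ Ideal.span {π (X o) - 1})⁄K])) := by
  obtain ⟨p, hp, hpk⟩ := exists_kaehlerDifferential_prod hπ hI o
  exact finite_and_eventually_finrank_imageForms_of_surjective hπ hI ho m
    Ideal.Quotient.mk_surjective Ideal.mk_ker p hp hpk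

end MvPolynomial

/-! ### The equivalence of the three conditions -/

section WeaklyCurvilinear

variable (K S : Type u) [Field K] [CommRing S] [Algebra K S]

theorem finrank_exteriorPower_one_prod [Module.Finite K S] [Module.Finite K (Ω[S⁄K])] :
    Module.finrank K (⋀[S]^1 (S × Ω[S⁄K])) = Module.finrank K S + Module.finrank K (Ω[S⁄K]) := by
  rw [← Module.finrank_prod]
  exact ((exteriorPower.oneEquiv S (S × Ω[S⁄K])).restrictScalars K).finrank_eq

theorem finrank_exteriorPower_two_prod [Subsingleton (KaehlerForms K S 2)] :
    Module.finrank K (⋀[S]^2 (S × Ω[S⁄K])) = Module.finrank K (Ω[S⁄K]) :=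
  ((exteriorPower.twoProdEquiv (S := S) (Q := Ω[S⁄K])).restrictScalars K).finrank_eq

theorem tfae_weaklyCurvilinear_not_smooth [PerfectField K] [Module.Finite K S]
    [∀ m, Module.Finite K (⋀[S]^m (S × Ω[S⁄K]))] {d : ℤ} {h : ℕ → ℤ}
    (hd : d = Module.finrank K S)
    (hh : ∀ m, h m = Module.finrank K (⋀[S]^m (S × Ω[S⁄K]))) :
    List.TFAE [
      HasWeaklyCurvilinearLocalRings S ∧ ¬ Algebra.Smooth K S,
      Nontrivial (Ω[S⁄K]) ∧ ∀ m : ℕ, 2 ≤ m → Subsingleton (KaehlerForms K S m),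
      h 1 > d ∧ h 2 = h 1 - d ∧ ∀ m : ℕ, 2 < m → h m = 0] := by
  have : Module.Finite K (Ω[S⁄K]) := Module.Finite.trans S _
  have h1 : h 1 = d + Module.finrank K (Ω[S⁄K]) := by
    rw [hd, hh, finrank_exteriorPower_one_prod, Nat.cast_add]
  tfae_have 1 ↔ 2 := by
    rw [hasWeaklyCurvilinearLocalRings_iff (K := K),
      Algebra.smooth_iff_subsingleton_kaehlerDifferential, not_subsingleton_iff_nontrivial,
      and_comm]
    exact and_congr_right fun _ =>
      ⟨fun _ m hm => exteriorPower.subsingleton_of_two_le hm, fun h => h 2 le_rfl⟩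
  tfae_have 2 → 3 := by
    rintro ⟨_, h2⟩
    have := h2 2 le_rfl
    have := Module.finrank_pos (R := K) (M := Ω[S⁄K])
    refine ⟨by omega, ?_, fun m hm => ?_⟩
    · rw [hh, finrank_exteriorPower_two_prod, h1, add_sub_cancel_left]
    · have := exteriorPower.subsingleton_prod_of_subsingleton (S := S) (Q := Ω[S⁄K]) hm
      rw [hh, Module.finrank_zero_of_subsingleton, Nat.cast_zero]
  tfae_have 3 → 2 := by
    rintro ⟨hlt, -, h3⟩
    -- The case `m = 3` suffices: contraction passes from `⋀³ (S × Ω)` to `⋀² Ω`, which controls all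
    -- higher forms.
    have : Subsingleton (⋀[S]^(2 + 1) (S × Ω[S⁄K])) :=
      (Module.finrank_zero_iff (R := K)).1 (by exact_mod_cast (hh 3).symm.trans (h3 3 (by omega)))
    have : Subsingleton (KaehlerForms K S 2) :=
      exteriorPower.subsingleton_of_subsingleton_prod
    exact ⟨Module.nontrivial_of_finrank_pos (R := K) (by omega),
      fun m hm => exteriorPower.subsingleton_of_two_le hm⟩
  tfae_finish

end WeaklyCurvilinear

/-! ### Application to the coordinate rings of `X` -/

namespace ZeroDimProjScheme

variable {K : Type u} [Field K] {n : ℕ} (X : ZeroDimProjScheme K n)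

theorem finite_and_eventually_hilbertFunction_eq :
    Module.Finite K X.affineCoordRing ∧
      ∀ᶠ i in Filter.atTop, X.hilbertFunction i = Module.finrank K X.affineCoordRing := by
  have hk : RingHom.ker (Ideal.Quotient.mkₐ K X.vanishingIdeal) = X.vanishingIdeal :=
    Ideal.mk_ker
  obtain ⟨h1, h2⟩ := MvPolynomial.finite_and_eventually_finrank_imageComponent
    (π := Ideal.Quotient.mkₐ K X.vanishingIdeal) Ideal.Quotient.mk_surjective
    (by rw [hk]; exact X.isHomogeneous) (o := 0) X.eventually_exists_x₀_mul_eq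
  exact ⟨h1, h2.mono fun i hi => congrArg Nat.cast hi⟩

theorem finite_and_eventually_formsHilbertFunction_eq (m : ℕ) :
    Module.Finite K (⋀[X.affineCoordRing]^m (X.affineCoordRing × Ω[X.affineCoordRing⁄K])) ∧
      ∀ᶠ i in Filter.atTop, X.formsHilbertFunction m i = Module.finrank K
        (⋀[X.affineCoordRing]^m (X.affineCoordRing × Ω[X.affineCoordRing⁄K])) := by
  have hk : RingHom.ker (Ideal.Quotient.mkₐ K X.vanishingIdeal) = X.vanishingIdeal :=
    Ideal.mk_ker
  have hI : (RingHom.ker (Ideal.Quotient.mkₐ K X.vanishingIdeal)).IsHomogeneous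
      (MvPolynomial.homogeneousSubmodule (Fin (n + 1)) K) := by
    rw [hk]; exact X.isHomogeneous
  obtain ⟨h1, h2⟩ := MvPolynomial.finite_and_eventually_finrank_imageForms
    (π := Ideal.Quotient.mkₐ K X.vanishingIdeal) Ideal.Quotient.mk_surjective hI (o := 0)
    X.eventually_exists_x₀_mul_eq m
  exact ⟨h1, h2.mono fun i hi => congrArg Nat.cast hi⟩

end ZeroDimProjScheme

theorem mainTheorem5 {K : Type*} [Field K] [PerfectField K] {n : ℕ} (X : ZeroDimProjScheme K n) :
    (∀ᶠ i in Filter.atTop, X.hilbertFunction i = X.degree) ∧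
    (∀ m : ℕ, 1 ≤ m →
      ∀ᶠ i in Filter.atTop, X.formsHilbertFunction m i = X.formsHilbertPoly m) ∧
    List.TFAE [
      X.IsWeaklyCurvilinear ∧ ¬ X.IsSmooth,
      Nontrivial (Ω[X.affineCoordRing⁄K]) ∧
        ∀ m : ℕ, 2 ≤ m → Subsingleton (KaehlerForms K X.affineCoordRing m),
      X.formsHilbertPoly 1 > X.degree ∧
        X.formsHilbertPoly 2 = X.formsHilbertPoly 1 - X.degree ∧
        ∀ m : ℕ, 2 < m → X.formsHilbertPoly m = 0] := by
  obtain ⟨_, h0⟩ := X.finite_and_eventually_hilbertFunction_eq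
  have hd := eventualValue_eq h0
  have hm (m : ℕ) := eventualValue_eq (X.finite_and_eventually_formsHilbertFunction_eq m).2
  have hfin (m : ℕ) := (X.finite_and_eventually_formsHilbertFunction_eq m).1
  refine ⟨h0.mono fun i hi => hi.trans hd.symm, fun m _ => ?_, ?_⟩
  · exact (X.finite_and_eventually_formsHilbertFunction_eq m).2.mono
      fun i hi => hi.trans (hm m).symm
  · exact tfae_weaklyCurvilinear_not_smooth K X.affineCoordRing hd hm
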